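/- For an integer $s\ge 0$ let $H^s_p(0,1)$ be the Sobolev space of real-valued functions $f\in H^s(0,1)$ with $\partial_x^n f(0)=\partial_x^n f(1)$ for $0\le n\le s-1$, with norm $\|f\|_{H^s}^2=\sum_{j=0}^s\|\partial_x^j f\|_{L^2(0,1)}^2$ (so $H^0_p(0,1)=L^2(0,1)$), and write $[f]=\int_0^1 f(x)\,dx$. Let $a_1,a_2,a_3,b_1,b_2,r,k$ be real constants with $k>0$, $b_1=b_2=1$ and $$r=0,\qquad a_1^2+a_2^2=a_1+a_2,\qquad |a_3|<1,\qquad (a_1-1)a_3=(a_2-1)a_3=0$$ (that is, either $a_3=0$ and $a_1^2+a_2^2=a_1+a_2$, or $0<|a_3|<1$ and $a_1=a_2=1$). Consider the damped Gear–Grimshaw system with periodic boundary conditions $$\begin{cases} u'+uu_x+u_{xxx}+a_3v_{xxx}+a_1vv_x+a_2(uv)_x+k(u-[u])=0,\\ b_1v'+rv_x+vv_x+v_{xxx}+b_2a_3u_{xxx}+b_2a_2uu_x+b_2a_1(uv)_x+k(v-[v])=0,\\ u(0,x)=\phi(x),\quad v(0,x)=\psi(x), \end{cases}$$ for $t\ge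 0$ and $0\le x\le 1$, where $'$ denotes $\partial_t$. Let $s\ge 3$ be an integer, let $\phi,\psi\in H^s_p(0,1)$, and let $(u,v)$ be the solution of the system in the class $$u,v\in C([0,\infty);H^s_p(0,1))\cap C^1([0,\infty);H^{s-3}_p(0,1)).$$ Then, for every real number $k'<k$, $$\|u(t)-[u(t)]\|_{H^s}+\|v(t)-[v(t)]\|_{H^s}=o\left(e^{-k't}\right)\qquad\text{as } t\to\infty.$$ -/

import Mathlib

open MeasureTheory Set Filter Asymptotics
open scoped ContDiff

noncomputable section

namespace GearGrimshaw

/-- Lebesgue measure on the interval `(0,1)`. -/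
abbrev mu01 : Measure ℝ := volume.restrict (Ioo (0 : ℝ) 1)

/-- The real Hilbert space `L²(0,1)`. -/
abbrev L2 : Type := Lp ℝ 2 mu01

/-- A smooth `1`-periodic test function on the line. -/
structure IsPeriodicTest (θ : ℝ → ℝ) : Prop where
  smooth : ContDiff ℝ ∞ θ
  periodic : Function.Periodic θ 1

/-- `g` is the weak derivative of `f` in `(0,1)` with periodic boundary conditions:
`∫ f θ' = - ∫ g θ` for all smooth `1`-periodic `θ`. Test functions supported in `(0,1)` say that
`g` is the weak derivative of `f`; those with `θ(0) = θ(1) ≠ 0` say that `f(0) = f(1)`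
for the continuous representative of `f`. -/
def IsPeriodicWeakDeriv (f g : L2) : Prop :=
  ∀ θ : ℝ → ℝ, IsPeriodicTest θ →
    ∫ x, f x * deriv θ x ∂mu01 = - ∫ x, g x * θ x ∂mu01

theorem integrable_mul_of_continuous (f : L2) {θ : ℝ → ℝ} (hθ : Continuous θ) :
    Integrable (fun x => f x * θ x) mu01 := by
  have hf : Integrable (fun x => f x) mu01 := (Lp.memLp f).integrable (by norm_num)
  obtain ⟨C, hC⟩ := (isCompact_Icc (a := (0 : ℝ)) (b := 1)).exists_bound_of_continuousOn
    hθ.continuousOn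
  refine hf.mul_bdd (c := C) hθ.aestronglyMeasurable ?_
  filter_upwards [ae_restrict_mem measurableSet_Ioo] with x hx
  exact hC x (Ioo_subset_Icc_self hx)

theorem IsPeriodicTest.continuous_deriv {θ : ℝ → ℝ} (hθ : IsPeriodicTest θ) :
    Continuous (deriv θ) :=
  hθ.smooth.continuous_deriv (by simp)

theorem IsPeriodicTest.integral_deriv {θ : ℝ → ℝ} (hθ : IsPeriodicTest θ) :
    ∫ x, deriv θ x ∂mu01 = 0 := by
  have h := intervalIntegral.integral_deriv_eq_sub (f := θ) (a := 0) (b := 1)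
    (fun x _ => (hθ.smooth.differentiable (by simp)) x)
    (hθ.continuous_deriv.intervalIntegrable _ _)
  rw [intervalIntegral.integral_of_le zero_le_one, integral_Ioc_eq_integral_Ioo] at h
  have hp := hθ.periodic 0
  rw [zero_add] at hp
  rw [h, hp, sub_self]

theorem IsPeriodicWeakDeriv.add {f g f' g' : L2} (h : IsPeriodicWeakDeriv f g)
    (h' : IsPeriodicWeakDeriv f' g') : IsPeriodicWeakDeriv (f + f') (g + g') := by
  intro θ hθ
  have e1 : ∫ x, (f + f') x * deriv θ x ∂mu01
      = ∫ x, (f x * deriv θ x + f' x * deriv θ x) ∂mu01 := by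
    refine integral_congr_ae ?_
    filter_upwards [Lp.coeFn_add f f'] with x hx
    simp only [hx, Pi.add_apply, add_mul]
  have e2 : ∫ x, (g + g') x * θ x ∂mu01 = ∫ x, (g x * θ x + g' x * θ x) ∂mu01 := by
    refine integral_congr_ae ?_
    filter_upwards [Lp.coeFn_add g g'] with x hx
    simp only [hx, Pi.add_apply, add_mul]
  rw [e1, e2,
    integral_add (integrable_mul_of_continuous f hθ.continuous_deriv)
      (integrable_mul_of_continuous f' hθ.continuous_deriv),
    integral_add (integrable_mul_of_continuous g hθ.smooth.continuous)
      (integrable_mul_of_continuous g' hθ.smooth.continuous), h θ hθ, h' θ hθ]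
  ring

theorem IsPeriodicWeakDeriv.smul {f g : L2} (c : ℝ) (h : IsPeriodicWeakDeriv f g) :
    IsPeriodicWeakDeriv (c • f) (c • g) := by
  intro θ hθ
  have e1 : ∫ x, (c • f) x * deriv θ x ∂mu01 = ∫ x, c * (f x * deriv θ x) ∂mu01 := by
    refine integral_congr_ae ?_
    filter_upwards [Lp.coeFn_smul c f] with x hx
    simp only [hx, Pi.smul_apply, smul_eq_mul, mul_assoc]
  have e2 : ∫ x, (c • g) x * θ x ∂mu01 = ∫ x, c * (g x * θ x) ∂mu01 := by
    refine integral_congr_ae ?_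
    filter_upwards [Lp.coeFn_smul c g] with x hx
    simp only [hx, Pi.smul_apply, smul_eq_mul, mul_assoc]
  rw [e1, e2, integral_const_mul, integral_const_mul, h θ hθ]
  ring

theorem isPeriodicWeakDeriv_zero : IsPeriodicWeakDeriv 0 0 := by
  intro θ _
  have e : ∀ η : ℝ → ℝ, ∫ x, (0 : L2) x * η x ∂mu01 = 0 := by
    intro η
    rw [integral_eq_zero_of_ae]
    filter_upwards [Lp.coeFn_zero ℝ 2 mu01] with x hx
    rw [hx]; exact zero_mul _
  rw [e, e, neg_zero]

theorem isPeriodicWeakDeriv_const (c : ℝ) : IsPeriodicWeakDeriv (Lp.const 2 mu01 c) 0 := by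
  intro θ hθ
  have e1 : ∫ x, (Lp.const 2 mu01 c : L2) x * deriv θ x ∂mu01 = ∫ x, c * deriv θ x ∂mu01 := by
    refine integral_congr_ae ?_
    filter_upwards [Lp.coeFn_const (p := 2) (μ := mu01) c] with x hx
    rw [hx, Function.const_apply]
  have e2 : ∫ x, (0 : L2) x * θ x ∂mu01 = 0 := by
    rw [integral_eq_zero_of_ae]
    filter_upwards [Lp.coeFn_zero ℝ 2 mu01] with x hx
    rw [hx]; exact zero_mul _
  rw [e1, e2, integral_const_mul, hθ.integral_deriv, mul_zero, neg_zero]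

/-- The tuples `(f, ∂ₓf, …, ∂ₓˢf)` in `L²(0,1)` of successive periodic weak derivatives. -/
def HperSubmodule (s : ℕ) : Submodule ℝ (PiLp 2 (fun _ : Fin (s + 1) => L2)) where
  carrier := {w | ∀ (j : ℕ) (hj : j < s),
    IsPeriodicWeakDeriv (w ⟨j, by omega⟩) (w ⟨j + 1, by omega⟩)}
  add_mem' := fun ha hb j hj => (ha j hj).add (hb j hj)
  zero_mem' := fun _ _ => isPeriodicWeakDeriv_zero
  smul_mem' := fun c _ ha j hj => (ha j hj).smul c

/-- The Sobolev space `H^s_p(0,1)` with periodic boundary conditions. A function `f` in it is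
represented by the tuple `(f, ∂ₓf, …, ∂ₓˢf)`, whose entries are determined by `f` because weak
derivatives are unique. The norm inherited from the `ℓ²`-product is the usual one,
`‖f‖² = ∑_{j ≤ s} ‖∂ₓʲ f‖²_{L²}`. -/
abbrev Hper (s : ℕ) : Type := HperSubmodule s

namespace Hper

/-- The derivative `∂ₓʲ w ∈ L²(0,1)` of `w ∈ H^s_p(0,1)`, for `j ≤ s`. -/
def dx {s : ℕ} (w : Hper s) (j : ℕ) (hj : j ≤ s) : L2 :=
  w.1 ⟨j, by omega⟩

/-- The function in `L²(0,1)` underlying an element of `H^s_p(0,1)`. -/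
def toL2 {s : ℕ} (w : Hper s) : L2 := w.dx 0 (Nat.zero_le s)

/-- The mean value `[w] = ∫₀¹ w(x) dx`. -/
def mean {s : ℕ} (w : Hper s) : ℝ := ∫ x, w.toL2 x ∂mu01

/-- The inclusion of `H^s_p(0,1)` in `H^r_p(0,1)`, for `r ≤ s`. -/
def incl {s : ℕ} (r : ℕ) (hr : r ≤ s) (w : Hper s) : Hper r :=
  ⟨WithLp.toLp 2 (fun i => w.dx i.1 (by omega)), fun j hj => w.2 j (by omega)⟩

/-- The constant function `c` as an element of `H^s_p(0,1)`. -/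
def const (s : ℕ) (c : ℝ) : Hper s :=
  ⟨WithLp.toLp 2 (fun i => if i.1 = 0 then Lp.const 2 mu01 c else 0), by
    intro j hj
    by_cases h : j = 0
    · subst h
      simpa using isPeriodicWeakDeriv_const c
    · simpa [h] using isPeriodicWeakDeriv_zero⟩

end Hper

/-- `(u, v)` is a solution on `[0,∞)`, with initial data `(φ, ψ)`, of the damped Gear–Grimshaw
system with periodic boundary conditions
`u' + u uₓ + uₓₓₓ + a₃ vₓₓₓ + a₁ v vₓ + a₂ (u v)ₓ + k (u - [u]) = 0`,
`b₁ v' + r vₓ + v vₓ + vₓₓₓ + b₂ a₃ uₓₓₓ + b₂ a₂ u uₓ + b₂ a₁ (u v)ₓ + k (v - [v]) = 0`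
in the class `C([0,∞); H^s_p(0,1)) ∩ C¹([0,∞); H^{s-3}_p(0,1))`. The equations hold as equalities of
elements of `L²(0,1)` for every `t ≥ 0`, the time derivative being taken in `H^{s-3}_p(0,1)`
(one-sided at `t = 0`). Values at `t < 0` are irrelevant. -/
structure IsSolution (a₁ a₂ a₃ b₁ b₂ r k : ℝ) {s : ℕ} (hs : 3 ≤ s) (φ ψ : Hper s)
    (u v : ℝ → Hper s) : Prop where
  cont_u : ContinuousOn u (Ici 0)
  cont_v : ContinuousOn v (Ici 0)
  contDiff_u : ContDiffOn ℝ 1 (fun t => (u t).incl (s - 3) (Nat.sub_le s 3)) (Ici 0)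
  contDiff_v : ContDiffOn ℝ 1 (fun t => (v t).incl (s - 3) (Nat.sub_le s 3)) (Ici 0)
  eq_u : ∀ t : ℝ, 0 ≤ t → ∀ᵐ x ∂mu01,
    (derivWithin (fun τ => (u τ).incl (s - 3) (Nat.sub_le s 3)) (Ici 0) t).toL2 x
      + (u t).toL2 x * (u t).dx 1 (by omega) x
      + (u t).dx 3 hs x
      + a₃ * (v t).dx 3 hs x
      + a₁ * ((v t).toL2 x * (v t).dx 1 (by omega) x)
      + a₂ * ((u t).dx 1 (by omega) x * (v t).toL2 x + (u t).toL2 x * (v t).dx 1 (by omega) x)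
      + k * ((u t).toL2 x - (u t).mean) = 0
  eq_v : ∀ t : ℝ, 0 ≤ t → ∀ᵐ x ∂mu01,
    b₁ * (derivWithin (fun τ => (v τ).incl (s - 3) (Nat.sub_le s 3)) (Ici 0) t).toL2 x
      + r * (v t).dx 1 (by omega) x
      + (v t).toL2 x * (v t).dx 1 (by omega) x
      + (v t).dx 3 hs x
      + b₂ * a₃ * (u t).dx 3 hs x
      + b₂ * a₂ * ((u t).toL2 x * (u t).dx 1 (by omega) x)
      + b₂ * a₁ * ((u t).dx 1 (by omega) x * (v t).toL2 x
          + (u t).toL2 x * (v t).dx 1 (by omega) x)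
      + k * ((v t).toL2 x - (v t).mean) = 0
  init_u : u 0 = φ
  init_v : v 0 = ψ

end GearGrimshaw

end

/-!
The damped Gear–Grimshaw system under consideration decouples into two scalar equations. The
quadratic nonlinearity is the `x`-derivative of the gradient of a cubic form; the condition
`a₁² + a₂² = a₁ + a₂` says that the two matrices of second derivatives of this form commute, so
that for `a₃ = 0` an orthogonal change of unknowns diagonalizes it. For `a₃ ≠ 0` the sum and the
difference of the unknowns do the same (`exists_isDecoupling`). After subtraction of the conserved
mean value, each new unknown solves
`z' + α zₓₓₓ + β zₓ + λ z zₓ + k z = 0` with `α > 0` (`IsDampedKdV`), and every spatial derivative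
of such a `z` is `O(e^{-kt})` in `L²` (`IsDampedKdV.decay`).

At orders zero, one and two this comes from the first conservation laws of the Korteweg–de Vries
equation: `‖z‖²` satisfies an exact identity, `α ‖zₓ‖² - (λ/3) ∫ z³` and
`α ‖zₓₓ‖² - (5/3) λ ∫ z zₓ²` are dissipated at the rate `2k` up to errors of higher order in
decaying quantities (`energy_identity_one`, `energy_identity_two`), and a Gronwall inequality
with the integrable rate `e^{-kt}` concludes (`exists_decay_of_energy`). For a solution in
`C(H³) ∩ C¹(L²)` the quantity `‖zₓₓ‖²` is not obviously differentiable in time; its derivative is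
computed for time averages of `z`, which are `C¹` with values in `H³`, and the averaging length is
sent to zero (`hasDerivAt_norm_sq_second`).

At order `n + 3` no further conservation law is used. A time increment `z(t+δ) - z(t)` solves a
linear equation whose coefficient is controlled by the `Hⁿ⁺²` norm of `z`, and it is regular enough
for the energy method in `Hⁿ` (`exists_increment_estimate`). Letting `δ → 0` after division by `δ`
shows that `z'` decays in `Hⁿ`, and the equation then yields `∂ⁿ⁺³z`.
-/

noncomputable section

namespace GearGrimshaw

open scoped RealInnerProductSpace Topology

/-! ### Periodic weak derivatives on the unit interval -/

theorem mu01_eq_Ioc : mu01 = volume.restrict (Ioc (0 : ℝ) 1) :=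
  restrict_Ioo_eq_restrict_Ioc

theorem integral_mu01 (f : ℝ → ℝ) : ∫ x, f x ∂mu01 = ∫ x in (0 : ℝ)..1, f x := by
  rw [intervalIntegral.integral_of_le zero_le_one, integral_Ioc_eq_integral_Ioo]

theorem isPeriodicTest_cos (n : ℤ) : IsPeriodicTest fun x => Real.cos (2 * Real.pi * n * x) where
  smooth := by fun_prop
  periodic x := by
    dsimp only
    rw [show 2 * Real.pi * n * (x + 1) = 2 * Real.pi * n * x + n * (2 * Real.pi) by ring,
      Real.cos_add_int_mul_two_pi]

theorem isPeriodicTest_sin (n : ℤ) : IsPeriodicTest fun x => Real.sin (2 * Real.pi * n * x) where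
  smooth := by fun_prop
  periodic x := by
    dsimp only
    rw [show 2 * Real.pi * n * (x + 1) = 2 * Real.pi * n * x + n * (2 * Real.pi) by ring,
      Real.sin_add_int_mul_two_pi]

/-- Completeness of the trigonometric system in `L²(0,1)`. -/
theorem ae_eq_zero_of_trig {f : ℝ → ℝ} (hf : MemLp f 2 mu01)
    (hc : ∀ n : ℤ, ∫ x, f x * Real.cos (2 * Real.pi * n * x) ∂mu01 = 0)
    (hs : ∀ n : ℤ, ∫ x, f x * Real.sin (2 * Real.pi * n * x) ∂mu01 = 0) :
    f =ᵐ[mu01] 0 := by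
  have hi : Integrable f mu01 := hf.integrable (by norm_num)
  have hF : MemLp (fun x => (f x : ℂ)) 2 (volume.restrict (Ioc (0 : ℝ) 1)) := by
    rw [← mu01_eq_Ioc]; exact hf.ofReal
  have hcoef : ∀ n : ℤ, fourierCoeffOn (zero_lt_one' ℝ) (fun x => (f x : ℂ)) n = 0 := by
    intro n
    rw [fourierCoeffOn_eq_integral, intervalIntegral.integral_of_le zero_le_one, ← mu01_eq_Ioc]
    have e : ∀ x : ℝ, fourier (-n) (x : AddCircle ((1 : ℝ) - 0)) • (f x : ℂ)
        = ((f x * Real.cos (2 * Real.pi * n * x) : ℝ) : ℂ)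
          - Complex.I * ((f x * Real.sin (2 * Real.pi * n * x) : ℝ) : ℂ) := by
      intro x
      rw [fourier_coe_apply]
      have : 2 * (Real.pi : ℂ) * Complex.I * ((-n : ℤ) : ℂ) * (x : ℂ) / (((1 : ℝ) - 0 : ℝ) : ℂ)
          = ((-(2 * Real.pi * n * x) : ℝ) : ℂ) * Complex.I := by
        push_cast; ring
      rw [this, Complex.exp_mul_I, ← Complex.ofReal_cos, ← Complex.ofReal_sin, Real.cos_neg,
        Real.sin_neg, smul_eq_mul]
      push_cast; ring
    have i1 : Integrable (fun x => f x * Real.cos (2 * Real.pi * n * x)) mu01 :=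
      hi.mul_bdd (c := 1) (by fun_prop) (by
        filter_upwards with x using by simpa using Real.abs_cos_le_one _)
    have i2 : Integrable (fun x => f x * Real.sin (2 * Real.pi * n * x)) mu01 :=
      hi.mul_bdd (c := 1) (by fun_prop) (by
        filter_upwards with x using by simpa using Real.abs_sin_le_one _)
    simp_rw [e]
    rw [integral_sub i1.ofReal (i2.ofReal.const_mul _), integral_const_mul,
      integral_complex_ofReal, integral_complex_ofReal, hc, hs]
    simp
  have h := hasSum_sq_fourierCoeffOn (zero_lt_one' ℝ) hF
  simp only [hcoef, norm_zero, ne_eq, OfNat.ofNat_ne_zero, not_false_eq_true, zero_pow] at h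
  have h0 := h.unique hasSum_zero
  rw [intervalIntegral.integral_of_le zero_le_one, ← mu01_eq_Ioc] at h0
  simp only [sub_zero, inv_one, one_smul, Complex.norm_real, Real.norm_eq_abs, sq_abs] at h0
  have h1 := (integral_eq_zero_iff_of_nonneg (fun x => sq_nonneg (f x)) hf.integrable_sq).1 h0
  filter_upwards [h1] with x hx
  simpa using hx

theorem L2_eq_zero_of_test {f : L2} (h : ∀ θ, IsPeriodicTest θ → ∫ x, f x * θ x ∂mu01 = 0) :
    f = 0 :=
  (Lp.eq_zero_iff_ae_eq_zero).2 (ae_eq_zero_of_trig (Lp.memLp f)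
    (fun n => h _ (isPeriodicTest_cos n)) (fun n => h _ (isPeriodicTest_sin n)))

theorem L2.integrable (f : L2) : Integrable (fun x => f x) mu01 :=
  (Lp.memLp f).integrable (by norm_num)

theorem L2.intervalIntegrable (f : L2) : IntervalIntegrable (fun x => f x) volume 0 1 := by
  rw [intervalIntegrable_iff_integrableOn_Ioo_of_le zero_le_one]; exact f.integrable

theorem real_inner_L2 (f g : L2) : ⟪f, g⟫ = ∫ x, f x * g x ∂mu01 := by
  rw [MeasureTheory.L2.inner_def]
  exact integral_congr_ae (by filter_upwards with x; simp [mul_comm])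

theorem L2.norm_sq (f : L2) : ‖f‖ ^ 2 = ∫ x, f x ^ 2 ∂mu01 := by
  rw [← real_inner_self_eq_norm_sq, real_inner_L2]; simp_rw [sq]

theorem L2.abs_integral_le (f : L2) : ∫ x, |f x| ∂mu01 ≤ ‖f‖ := by
  have h : (∫ x, |f x| ∂mu01) ^ 2 ≤ ∫ x, |f x| ^ 2 ∂mu01 := by
    have := integral_mono (μ := mu01) (f := fun x => 2 * (∫ y, |f y| ∂mu01) * |f x|
      - (∫ y, |f y| ∂mu01) ^ 2) (g := fun x => |f x| ^ 2)
      ((f.integrable.abs.const_mul _).sub (integrable_const _))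
      (by simpa using (Lp.memLp f).integrable_sq) (fun x => by
        dsimp; nlinarith [sq_nonneg (|f x| - ∫ y, |f y| ∂mu01)])
    rw [integral_sub (f.integrable.abs.const_mul _) (integrable_const _), integral_const_mul,
      integral_const] at this
    simp at this
    simp only [sq_abs]
    nlinarith
  simp only [sq_abs] at h
  rw [← L2.norm_sq] at h
  exact (abs_le_of_sq_le_sq' h (norm_nonneg _)).2

theorem IsPeriodicWeakDeriv.integral_eq_zero {f g : L2} (h : IsPeriodicWeakDeriv f g) :
    ∫ x, g x ∂mu01 = 0 := by
  have := h (fun _ => 1) ⟨contDiff_const, fun _ => rfl⟩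
  simpa using this

/-- An `L²` function with a periodic weak derivative `g` has the absolutely continuous
representative `c + ∫₀ˣ g`, with equal values at the ends, and `|c| ≤ ‖f‖ + ‖g‖`. -/
theorem IsPeriodicWeakDeriv.exists_const {f g : L2} (h : IsPeriodicWeakDeriv f g) :
    ∃ c : ℝ, |c| ≤ ‖f‖ + ‖g‖ ∧ ∀ᵐ x ∂mu01, f x = c + ∫ y in (0 : ℝ)..x, g y := by
  set G : ℝ → ℝ := fun x => ∫ y in (0 : ℝ)..x, g y with hG
  have hAC : AbsolutelyContinuousOnInterval G 0 1 :=
    g.intervalIntegrable.absolutelyContinuousOnInterval_intervalIntegral (by simp)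
  have hG0 : G 0 = 0 := by simp [hG]
  have hG1 : G 1 = 0 := by rw [hG]; dsimp only; rw [← integral_mu01, h.integral_eq_zero]
  have hbd : ∀ x ∈ Icc (0 : ℝ) 1, |G x| ≤ ‖g‖ := by
    intro x hx
    calc |G x| ≤ ∫ y in (0 : ℝ)..x, |g y| := intervalIntegral.abs_integral_le_integral_abs hx.1
      _ ≤ ∫ y in (0 : ℝ)..1, |g y| :=
        intervalIntegral.integral_mono_interval le_rfl hx.1 hx.2
          (by filter_upwards with y using abs_nonneg _) g.intervalIntegrable.abs
      _ ≤ ‖g‖ := by rw [← integral_mu01]; exact g.abs_integral_le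
  have hcont : ContinuousOn G (Icc 0 1) := by
    have := hAC.continuousOn; rwa [uIcc_of_le zero_le_one] at this
  have hbd' : ∀ᵐ x ∂mu01, ‖G x‖ ≤ ‖g‖ := by
    filter_upwards [ae_restrict_mem measurableSet_Ioo] with x hx
    exact hbd x (Ioo_subset_Icc_self hx)
  have hGm : MemLp G 2 mu01 := MemLp.of_bound
    ((hcont.mono Ioo_subset_Icc_self).aestronglyMeasurable measurableSet_Ioo) ‖g‖ hbd'
  have hGi : Integrable G mu01 := hGm.integrable (by norm_num)
  set c : ℝ := ∫ x, (f x - G x) ∂mu01 with hc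
  have hcb : |c| ≤ ‖f‖ + ‖g‖ := by
    rw [hc, integral_sub f.integrable hGi]
    refine (abs_sub _ _).trans (add_le_add ?_ ?_)
    · exact (abs_integral_le_integral_abs).trans f.abs_integral_le
    · have := norm_integral_le_of_norm_le_const hbd'
      simpa using this
  -- Integration by parts against `G` shows that `f - G` is orthogonal to derivatives of tests.
  have key : ∀ θ, IsPeriodicTest θ → ∫ x, (f x - G x - c) * deriv θ x ∂mu01 = 0 := by
    intro θ hθ
    have hθAC : AbsolutelyContinuousOnInterval θ 0 1 :=
      (hθ.smooth.contDiffOn.of_le (by simp)).absolutelyContinuousOnInterval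
    have ibp := hAC.integral_mul_deriv_eq_deriv_mul hθAC
    rw [hG0, hG1, zero_mul, zero_mul, sub_zero, zero_sub] at ibp
    have e : ∫ x in (0 : ℝ)..1, deriv G x * θ x = ∫ x in (0 : ℝ)..1, g x * θ x := by
      apply intervalIntegral.integral_congr_ae
      filter_upwards [g.intervalIntegrable.ae_hasDerivAt_integral] with x hx hx'
      rw [(hx (uIoc_subset_uIcc hx') 0 (by simp)).deriv]
    rw [e, ← integral_mu01, ← integral_mu01, ← h θ hθ] at ibp
    have i1 := integrable_mul_of_continuous f hθ.continuous_deriv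
    have i2 : Integrable (fun x => G x * deriv θ x) mu01 := by
      have := integrable_mul_of_continuous hGm.toLp hθ.continuous_deriv
      refine this.congr ?_
      filter_upwards [hGm.coeFn_toLp] with x hx using by rw [hx]
    have i3 : Integrable (fun x => c * deriv θ x) mu01 := by
      have := integrable_mul_of_continuous (Lp.const 2 mu01 c) hθ.continuous_deriv
      refine this.congr ?_
      filter_upwards [Lp.coeFn_const (p := 2) (μ := mu01) c] with x hx using by
        rw [hx, Function.const_apply]
    have i12 : Integrable (fun x => f x * deriv θ x - G x * deriv θ x) mu01 := i1.sub i2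
    simp_rw [sub_mul]
    rw [integral_sub i12 i3, integral_sub i1 i2, integral_const_mul, hθ.integral_deriv,
      ibp]
    ring
  have hm : MemLp (fun x => f x - G x - c) 2 mu01 :=
    ((Lp.memLp f).sub hGm).sub (memLp_const c)
  have hz : ∫ x, (f x - G x - c) ∂mu01 = 0 := by
    have hi : Integrable (fun x => f x - G x) mu01 := f.integrable.sub hGi
    rw [integral_sub hi (integrable_const _), ← hc]; simp
  have hae := ae_eq_zero_of_trig hm (fun n => ?_) (fun n => ?_)
  · refine ⟨c, hcb, ?_⟩
    filter_upwards [hae] with x hx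
    have hx : f x - G x - c = 0 := hx
    linarith
  · rcases eq_or_ne n 0 with rfl | hn
    · simpa using hz
    · have := key _ (isPeriodicTest_sin n)
      have hd : deriv (fun x => Real.sin (2 * Real.pi * n * x))
          = fun x => 2 * Real.pi * n * Real.cos (2 * Real.pi * n * x) := by
        ext x
        have : HasDerivAt (fun x : ℝ => Real.sin (2 * Real.pi * n * x))
          (Real.cos (2 * Real.pi * n * x) * (2 * Real.pi * n)) x := by
          simpa using ((hasDerivAt_id x).const_mul (2 * Real.pi * n)).sin
        rw [this.deriv, mul_comm]
      simp_rw [hd, mul_left_comm _ (2 * Real.pi * (n : ℝ))] at this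
      rw [integral_const_mul] at this
      have hne : 2 * Real.pi * (n : ℝ) ≠ 0 := by
        have : (n : ℝ) ≠ 0 := by exact_mod_cast hn
        positivity
      exact (mul_eq_zero.1 this).resolve_left hne
  · rcases eq_or_ne n 0 with rfl | hn
    · simp
    · have := key _ (isPeriodicTest_cos n)
      have hd : deriv (fun x => Real.cos (2 * Real.pi * n * x))
          = fun x => -(2 * Real.pi * n) * Real.sin (2 * Real.pi * n * x) := by
        ext x
        have : HasDerivAt (fun x : ℝ => Real.cos (2 * Real.pi * n * x))
          (-Real.sin (2 * Real.pi * n * x) * (2 * Real.pi * n)) x := by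
          simpa using ((hasDerivAt_id x).const_mul (2 * Real.pi * n)).cos
        rw [this.deriv]; ring
      simp_rw [hd, mul_left_comm _ (-(2 * Real.pi * (n : ℝ)))] at this
      rw [integral_const_mul] at this
      have hne : -(2 * Real.pi * (n : ℝ)) ≠ 0 := by
        have : (n : ℝ) ≠ 0 := by exact_mod_cast hn
        have := Real.pi_ne_zero
        simp [*]
      exact (mul_eq_zero.1 this).resolve_left hne

/-- The Sobolev embedding of `H¹` into `L^∞`. -/
theorem IsPeriodicWeakDeriv.abs_le {f g : L2} (h : IsPeriodicWeakDeriv f g) :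
    ∀ᵐ x ∂mu01, |f x| ≤ 2 * (‖f‖ + ‖g‖) := by
  obtain ⟨c, hc, hf⟩ := h.exists_const
  filter_upwards [hf, ae_restrict_mem measurableSet_Ioo] with x hx hx'
  rw [hx]
  have : |∫ y in (0 : ℝ)..x, g y| ≤ ‖g‖ :=
    calc _ ≤ ∫ y in (0 : ℝ)..x, |g y| := intervalIntegral.abs_integral_le_integral_abs hx'.1.le
      _ ≤ ∫ y in (0 : ℝ)..1, |g y| :=
        intervalIntegral.integral_mono_interval le_rfl hx'.1.le hx'.2.le
          (by filter_upwards with y using abs_nonneg _) g.intervalIntegrable.abs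
      _ ≤ ‖g‖ := by rw [← integral_mu01]; exact g.abs_integral_le
  linarith [abs_add_le c (∫ y in (0 : ℝ)..x, g y), norm_nonneg f]

/-- Integration by parts: the periodic weak derivative is skew-symmetric. -/
theorem IsPeriodicWeakDeriv.inner_eq_neg {f f' g g' : L2} (hf : IsPeriodicWeakDeriv f f')
    (hg : IsPeriodicWeakDeriv g g') : ⟪f, g'⟫ = -⟪f', g⟫ := by
  obtain ⟨a, -, ha⟩ := hf.exists_const
  obtain ⟨b, -, hb⟩ := hg.exists_const
  have hF : AbsolutelyContinuousOnInterval (fun x => a + ∫ y in (0 : ℝ)..x, f' y) 0 1 := by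
    refine AbsolutelyContinuousOnInterval.add (f := fun _ => a) ?_
      (f'.intervalIntegrable.absolutelyContinuousOnInterval_intervalIntegral (by simp))
    exact (contDiff_const.contDiffOn (n := 1)).absolutelyContinuousOnInterval
  have hG : AbsolutelyContinuousOnInterval (fun x => b + ∫ y in (0 : ℝ)..x, g' y) 0 1 := by
    refine AbsolutelyContinuousOnInterval.add (f := fun _ => b) ?_
      (g'.intervalIntegrable.absolutelyContinuousOnInterval_intervalIntegral (by simp))
    exact (contDiff_const.contDiffOn (n := 1)).absolutelyContinuousOnInterval
  have ibp := hF.integral_mul_deriv_eq_deriv_mul hG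
  have e1 : ∫ x in (0 : ℝ)..1, f' x = 0 := by rw [← integral_mu01, hf.integral_eq_zero]
  have e2 : ∫ x in (0 : ℝ)..1, g' x = 0 := by rw [← integral_mu01, hg.integral_eq_zero]
  rw [e1, e2] at ibp
  simp only [intervalIntegral.integral_same, sub_self, zero_sub] at ibp
  have d1 : ∀ᵐ x ∂mu01, deriv (fun x => a + ∫ y in (0 : ℝ)..x, f' y) x = f' x := by
    rw [ae_restrict_iff' measurableSet_Ioo]
    filter_upwards [f'.intervalIntegrable.ae_hasDerivAt_integral] with x hx hx'
    have hx' : x ∈ uIcc (0 : ℝ) 1 := by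
      rw [uIcc_of_le zero_le_one]; exact Ioo_subset_Icc_self hx'
    exact ((hx hx' 0 (by simp)).const_add a).deriv
  have d2 : ∀ᵐ x ∂mu01, deriv (fun x => b + ∫ y in (0 : ℝ)..x, g' y) x = g' x := by
    rw [ae_restrict_iff' measurableSet_Ioo]
    filter_upwards [g'.intervalIntegrable.ae_hasDerivAt_integral] with x hx hx'
    have hx' : x ∈ uIcc (0 : ℝ) 1 := by
      rw [uIcc_of_le zero_le_one]; exact Ioo_subset_Icc_self hx'
    exact ((hx hx' 0 (by simp)).const_add b).deriv
  rw [← integral_mu01, ← integral_mu01] at ibp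
  rw [real_inner_L2, real_inner_L2]
  refine Eq.trans ?_ (ibp.trans (congrArg Neg.neg ?_))
  · apply integral_congr_ae
    filter_upwards [ha, d2] with x h1 h2 using by rw [h1, h2]
  · apply integral_congr_ae
    filter_upwards [hb, d1] with x h1 h2 using by rw [h1, h2]

theorem IsPeriodicWeakDeriv.unique {f g g' : L2} (h : IsPeriodicWeakDeriv f g)
    (h' : IsPeriodicWeakDeriv f g') : g = g' := by
  rw [← sub_eq_zero]
  have h0 := h.add (h'.smul (-1))
  refine L2_eq_zero_of_test fun θ hθ => ?_
  have := h0 θ hθ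
  have e : f + (-1 : ℝ) • f = 0 := by simp
  rw [e, (isPeriodicWeakDeriv_zero θ hθ)] at this
  have e2 : g + (-1 : ℝ) • g' = g - g' := by simp [sub_eq_add_neg]
  rw [e2] at this
  have hz : ∫ x, (0 : L2) x * θ x ∂mu01 = 0 := by
    rw [integral_eq_zero_of_ae]
    filter_upwards [Lp.coeFn_zero ℝ 2 mu01] with x hx
    rw [hx]; exact zero_mul _
  linarith

/-! ### Products and towers of derivatives -/

/-- The pointwise product of two elements of `L²(0,1)`, with the value `0` when the product is not
square integrable. It is only used when one of the factors is essentially bounded. -/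
def mulL2 (f g : L2) : L2 :=
  open Classical in
  if h : MemLp (fun x => f x * g x) 2 mu01 then h.toLp else 0

theorem coeFn_mulL2 {f : L2} (hf : MemLp f ⊤ mu01) (g : L2) :
    mulL2 f g =ᵐ[mu01] fun x => f x * g x := by
  have h : MemLp (fun x => f x * g x) 2 mu01 := (Lp.memLp g).mul' hf
  rw [mulL2, dif_pos h]
  exact h.coeFn_toLp

theorem mulL2_comm (f g : L2) : mulL2 f g = mulL2 g f := by
  have e : (fun x => f x * g x) = fun x => g x * f x := funext fun x => mul_comm _ _
  by_cases h : MemLp (fun x => f x * g x) 2 mu01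
  · have h' : MemLp (fun x => g x * f x) 2 mu01 := e ▸ h
    rw [mulL2, mulL2, dif_pos h, dif_pos h']
    exact MemLp.toLp_congr h h' (by rw [e])
  · have h' : ¬ MemLp (fun x => g x * f x) 2 mu01 := e ▸ h
    rw [mulL2, mulL2, dif_neg h, dif_neg h']

theorem coeFn_mulL2_right (f : L2) {g : L2} (hg : MemLp g ⊤ mu01) :
    mulL2 f g =ᵐ[mu01] fun x => f x * g x := by
  rw [mulL2_comm]
  simpa only [mul_comm] using coeFn_mulL2 hg f

theorem IsPeriodicWeakDeriv.memLp_top {f g : L2} (h : IsPeriodicWeakDeriv f g) :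
    MemLp f ⊤ mu01 :=
  memLp_top_of_bound (Lp.memLp f).1 _ h.abs_le

theorem IsPeriodicWeakDeriv.norm_mulL2_le {f f' : L2} (h : IsPeriodicWeakDeriv f f') (g : L2) :
    ‖mulL2 f g‖ ≤ 2 * (‖f‖ + ‖f'‖) * ‖g‖ := by
  refine Lp.norm_le_mul_norm_of_ae_le_mul ?_
  filter_upwards [coeFn_mulL2 h.memLp_top g, h.abs_le] with x h1 h2
  rw [h1, norm_mul]
  exact mul_le_mul_of_nonneg_right h2 (norm_nonneg _)

theorem mulL2_sub_sub {f f₀ : L2} (hf : MemLp f ⊤ mu01) (hf₀ : MemLp f₀ ⊤ mu01) (g g₀ : L2) :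
    mulL2 f g - mulL2 f₀ g₀ = mulL2 (f - f₀) g + mulL2 f₀ (g - g₀) := by
  have h : MemLp (f - f₀ : L2) ⊤ mu01 := (memLp_congr_ae (Lp.coeFn_sub f f₀)).2 (hf.sub hf₀)
  refine Lp.ext ?_
  filter_upwards [coeFn_mulL2 hf g, coeFn_mulL2 hf₀ g₀, coeFn_mulL2 h g,
    coeFn_mulL2 hf₀ (g - g₀), Lp.coeFn_sub f f₀, Lp.coeFn_sub g g₀,
    Lp.coeFn_sub (mulL2 f g) (mulL2 f₀ g₀),
    Lp.coeFn_add (mulL2 (f - f₀) g) (mulL2 f₀ (g - g₀))] with x h1 h2 h3 h4 h5 h6 h7 h8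
  simp only [h7, h8, Pi.sub_apply, Pi.add_apply, h1, h2, h3, h4, h5, h6]
  ring

theorem memLp_top_of_continuous {θ : ℝ → ℝ} (hθ : Continuous θ) : MemLp θ ⊤ mu01 := by
  obtain ⟨C, hC⟩ := (isCompact_Icc (a := (0 : ℝ)) (b := 1)).exists_bound_of_continuousOn
    hθ.continuousOn
  refine memLp_top_of_bound hθ.aestronglyMeasurable C ?_
  filter_upwards [ae_restrict_mem measurableSet_Ioo] with x hx
  exact hC x (Ioo_subset_Icc_self hx)

theorem IsPeriodicTest.mul {θ η : ℝ → ℝ} (hθ : IsPeriodicTest θ) (hη : IsPeriodicTest η) :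
    IsPeriodicTest fun x => θ x * η x :=
  ⟨hθ.smooth.mul hη.smooth, hθ.periodic.mul hη.periodic⟩

theorem IsPeriodicTest.deriv_mul {θ η : ℝ → ℝ} (hθ : IsPeriodicTest θ) (hη : IsPeriodicTest η)
    (x : ℝ) : deriv (fun x => θ x * η x) x = deriv θ x * η x + θ x * deriv η x :=
  ((hθ.smooth.differentiable (by simp) x).hasDerivAt.mul
    (hη.smooth.differentiable (by simp) x).hasDerivAt).deriv

/-- The product rule for periodic weak derivatives. -/
theorem IsPeriodicWeakDeriv.mul {f f' g g' : L2} (hf : IsPeriodicWeakDeriv f f')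
    (hg : IsPeriodicWeakDeriv g g') :
    IsPeriodicWeakDeriv (mulL2 f g) (mulL2 f' g + mulL2 f g') := by
  intro θ hθ
  have mθ := memLp_top_of_continuous hθ.smooth.continuous
  have mθ' := memLp_top_of_continuous hθ.continuous_deriv
  have pθ : MemLp (fun x => g x * θ x) 2 mu01 := by
    simpa only [mul_comm] using (Lp.memLp g).mul' mθ
  have pθ' : MemLp (fun x => g' x * θ x + g x * deriv θ x) 2 mu01 := by
    refine MemLp.add ?_ ?_
    · simpa only [mul_comm] using (Lp.memLp g').mul' mθ
    · simpa only [mul_comm] using (Lp.memLp g).mul' mθ'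
  have hgθ : IsPeriodicWeakDeriv (pθ.toLp _) (pθ'.toLp _) := by
    intro η hη
    have h := hg _ (hθ.mul hη)
    simp_rw [hθ.deriv_mul hη] at h
    have c1 := hθ.continuous_deriv.mul hη.smooth.continuous
    have c2 := hθ.smooth.continuous.mul hη.continuous_deriv
    have c3 := hθ.smooth.continuous.mul hη.smooth.continuous
    have i1 : Integrable (fun x => g x * (deriv θ x * η x)) mu01 :=
      integrable_mul_of_continuous g c1
    have i2 : Integrable (fun x => g x * (θ x * deriv η x)) mu01 :=
      integrable_mul_of_continuous g c2
    have i3 : Integrable (fun x => g' x * (θ x * η x)) mu01 :=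
      integrable_mul_of_continuous g' c3
    simp_rw [mul_add] at h
    rw [integral_add i1 i2] at h
    have e1 : ∫ x, pθ.toLp _ x * deriv η x ∂mu01 = ∫ x, g x * (θ x * deriv η x) ∂mu01 := by
      apply integral_congr_ae
      filter_upwards [pθ.coeFn_toLp] with x hx using by rw [hx]; ring
    have e2 : ∫ x, pθ'.toLp _ x * η x ∂mu01
        = ∫ x, (g' x * (θ x * η x) + g x * (deriv θ x * η x)) ∂mu01 := by
      apply integral_congr_ae
      filter_upwards [pθ'.coeFn_toLp] with x hx using by rw [hx]; ring
    rw [e1, e2, integral_add i3 i1]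
    linarith
  have key := hf.inner_eq_neg hgθ
  rw [real_inner_L2, real_inner_L2] at key
  have tf := hf.memLp_top
  have tg := hg.memLp_top
  have i1 : Integrable (fun x => (f x * g x) * deriv θ x) mu01 := by
    refine (integrable_mul_of_continuous (mulL2 f g) hθ.continuous_deriv).congr ?_
    filter_upwards [coeFn_mulL2 tf g] with x hx using by rw [hx]
  have i2 : Integrable (fun x => (f x * g' x) * θ x) mu01 := by
    refine (integrable_mul_of_continuous (mulL2 f g') hθ.smooth.continuous).congr ?_
    filter_upwards [coeFn_mulL2 tf g'] with x hx using by rw [hx]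
  have i3 : Integrable (fun x => (f' x * g x) * θ x) mu01 := by
    refine (integrable_mul_of_continuous (mulL2 f' g) hθ.smooth.continuous).congr ?_
    filter_upwards [coeFn_mulL2_right f' tg] with x hx using by rw [hx]
  have e1 : ∫ x, mulL2 f g x * deriv θ x ∂mu01
      = ∫ x, (f x * g x) * deriv θ x ∂mu01 := by
    apply integral_congr_ae
    filter_upwards [coeFn_mulL2 tf g] with x hx using by rw [hx]
  have e2 : ∫ x, (mulL2 f' g + mulL2 f g') x * θ x ∂mu01
      = ∫ x, ((f' x * g x) * θ x + (f x * g' x) * θ x) ∂mu01 := by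
    apply integral_congr_ae
    filter_upwards [coeFn_mulL2 tf g', coeFn_mulL2_right f' tg,
      Lp.coeFn_add (mulL2 f' g) (mulL2 f g')] with x h1 h2 h3
    rw [h3, Pi.add_apply, h1, h2, add_mul]
  have e3 : ∫ x, f x * pθ'.toLp _ x ∂mu01
      = ∫ x, ((f x * g' x) * θ x + (f x * g x) * deriv θ x) ∂mu01 := by
    apply integral_congr_ae
    filter_upwards [pθ'.coeFn_toLp] with x hx using by rw [hx]; ring
  have e4 : ∫ x, f' x * pθ.toLp _ x ∂mu01 = ∫ x, (f' x * g x) * θ x ∂mu01 := by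
    apply integral_congr_ae
    filter_upwards [pθ.coeFn_toLp] with x hx using by rw [hx]; ring
  rw [e3, e4, integral_add i2 i1] at key
  rw [e1, e2, integral_add i3 i2]
  linarith

theorem inner_mulL2 {f : L2} (hf : MemLp f ⊤ mu01) (g h : L2) :
    ⟪mulL2 f g, h⟫ = ∫ x, f x * g x * h x ∂mu01 := by
  rw [real_inner_L2]
  apply integral_congr_ae
  filter_upwards [coeFn_mulL2 hf g] with x hx using by rw [hx]

/-- `p 0, p 1, …, p n` are successive periodic weak derivatives of `p 0`. -/
def IsTower (n : ℕ) (p : ℕ → L2) : Prop :=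
  ∀ i < n, IsPeriodicWeakDeriv (p i) (p (i + 1))

/-- The Sobolev norm `∑_{i ≤ n} ‖∂ⁱ p‖` of a tower of derivatives. -/
def towerNorm (n : ℕ) (p : ℕ → L2) : ℝ := ∑ i ∈ Finset.range (n + 1), ‖p i‖

theorem towerNorm_nonneg (n : ℕ) (p : ℕ → L2) : 0 ≤ towerNorm n p :=
  Finset.sum_nonneg fun _ _ => norm_nonneg _

theorem norm_le_towerNorm {n i : ℕ} (h : i ≤ n) (p : ℕ → L2) : ‖p i‖ ≤ towerNorm n p :=
  Finset.single_le_sum (f := fun i => ‖p i‖) (fun _ _ => norm_nonneg _)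
    (Finset.mem_range.2 (by omega))

theorem towerNorm_mono {m n : ℕ} (h : m ≤ n) (p : ℕ → L2) : towerNorm m p ≤ towerNorm n p :=
  Finset.sum_le_sum_of_subset_of_nonneg (Finset.range_mono (by omega))
    fun _ _ _ => norm_nonneg _

theorem towerNorm_shift_le (n : ℕ) (p : ℕ → L2) :
    towerNorm n (fun i => p (i + 1)) ≤ towerNorm (n + 1) p := by
  rw [towerNorm, towerNorm, Finset.sum_range_succ' _ (n + 1)]
  linarith [norm_nonneg (p 0)]

theorem towerNorm_add_le (n : ℕ) (p q : ℕ → L2) :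
    towerNorm n (fun i => p i + q i) ≤ towerNorm n p + towerNorm n q := by
  rw [towerNorm, towerNorm, towerNorm, ← Finset.sum_add_distrib]
  exact Finset.sum_le_sum fun i _ => norm_add_le _ _

theorem towerNorm_smul (n : ℕ) (c : ℝ) (p : ℕ → L2) :
    towerNorm n (fun i => c • p i) = |c| * towerNorm n p := by
  rw [towerNorm, towerNorm, Finset.mul_sum]
  exact Finset.sum_congr rfl fun i _ => norm_smul _ _

theorem IsTower.mono {m n : ℕ} {p : ℕ → L2} (h : IsTower n p) (hmn : m ≤ n) : IsTower m p :=
  fun i hi => h i (by omega)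

theorem IsTower.shift {n : ℕ} {p : ℕ → L2} (h : IsTower (n + 1) p) :
    IsTower n (fun i => p (i + 1)) :=
  fun i hi => h (i + 1) (by omega)

theorem IsTower.add {n : ℕ} {p q : ℕ → L2} (hp : IsTower n p) (hq : IsTower n q) :
    IsTower n (fun i => p i + q i) :=
  fun i hi => (hp i hi).add (hq i hi)

theorem IsTower.smul {n : ℕ} {p : ℕ → L2} (c : ℝ) (hp : IsTower n p) :
    IsTower n (fun i => c • p i) :=
  fun i hi => (hp i hi).smul c

/-- The sequence `f, p 0, p 1, …`. -/
def consSeq (f : L2) (p : ℕ → L2) : ℕ → L2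
  | 0 => f
  | i + 1 => p i

theorem IsTower.cons {n : ℕ} {p : ℕ → L2} {f : L2} (hp : IsTower n p)
    (hf : IsPeriodicWeakDeriv f (p 0)) : IsTower (n + 1) (consSeq f p) := by
  rintro (_ | i) hi
  · exact hf
  · exact hp i (by omega)

theorem IsTower.unique {n : ℕ} {p q : ℕ → L2} (hp : IsTower n p) (hq : IsTower n q)
    (h : p 0 = q 0) : ∀ i ≤ n, p i = q i := by
  intro i
  induction i with
  | zero => exact fun _ => h
  | succ i ih =>
    intro hi
    have h1 := hp i (by omega)
    rw [ih (by omega)] at h1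
    exact h1.unique (hq i (by omega))

/-- Boundedness of the product `Hⁿ × Hⁿ⁺¹ → Hⁿ`. -/
theorem exists_tower_mulL2 (n : ℕ) : ∃ C : ℝ, 0 ≤ C ∧ ∀ p q : ℕ → L2,
    IsTower n p → IsTower (n + 1) q → ∃ P : ℕ → L2, IsTower n P ∧ P 0 = mulL2 (p 0) (q 0) ∧
      ∀ i ≤ n, ‖P i‖ ≤ C * towerNorm n p * towerNorm (n + 1) q := by
  induction n with
  | zero =>
    refine ⟨2, by norm_num, fun p q _ hq => ⟨fun _ => mulL2 (p 0) (q 0), ?_, rfl, ?_⟩⟩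
    · intro i hi; omega
    · intro i _
      have := (hq 0 (by omega)).norm_mulL2_le (p 0)
      rw [mulL2_comm] at this
      refine this.trans (le_of_eq ?_)
      simp only [towerNorm, Finset.sum_range_succ, Finset.sum_range_zero]
      ring
  | succ n ih =>
    obtain ⟨C, hC, ih⟩ := ih
    refine ⟨2 * C + 2, by positivity, fun p q hp hq => ?_⟩
    obtain ⟨A, hA, hA0, hAb⟩ := ih _ _ hp.shift (hq.mono (by omega))
    obtain ⟨B, hB, hB0, hBb⟩ := ih _ _ (hp.mono (Nat.le_succ n)) hq.shift
    have hd : IsPeriodicWeakDeriv (mulL2 (p 0) (q 0)) (A 0 + B 0) := by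
      rw [hA0, hB0]
      exact (hp 0 (by omega)).mul (hq 0 (by omega))
    refine ⟨_, (hA.add hB).cons hd, rfl, ?_⟩
    have n1 := towerNorm_nonneg (n + 1) p
    have n2 := towerNorm_nonneg (n + 1 + 1) q
    have hpq := mul_nonneg n1 n2
    rintro (_ | i) hi
    · have := (hq 0 (by omega)).norm_mulL2_le (p 0)
      rw [mulL2_comm] at this
      have h1 : ‖q 0‖ + ‖q (0 + 1)‖ ≤ towerNorm (n + 1 + 1) q := by
        refine le_trans (le_of_eq ?_) (towerNorm_mono (show 1 ≤ n + 1 + 1 by omega) q)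
        simp [towerNorm, Finset.sum_range_succ]
      have h2 := norm_le_towerNorm (Nat.zero_le (n + 1)) p
      have h3 : (‖q 0‖ + ‖q (0 + 1)‖) * ‖p 0‖
          ≤ towerNorm (n + 1 + 1) q * towerNorm (n + 1) p :=
        mul_le_mul h1 h2 (norm_nonneg _) n2
      simp only [consSeq]
      nlinarith
    · have a := hAb i (by omega)
      have b := hBb i (by omega)
      have a1 : towerNorm n (fun i => p (i + 1)) * towerNorm (n + 1) q
          ≤ towerNorm (n + 1) p * towerNorm (n + 1 + 1) q :=
        mul_le_mul (towerNorm_shift_le n p) (towerNorm_mono (by omega) q)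
          (towerNorm_nonneg _ _) n1
      have b1 : towerNorm n p * towerNorm (n + 1) (fun i => q (i + 1))
          ≤ towerNorm (n + 1) p * towerNorm (n + 1 + 1) q :=
        mul_le_mul (towerNorm_mono (by omega) p) (towerNorm_shift_le _ q)
          (towerNorm_nonneg _ _) n1
      have a2 := mul_le_mul_of_nonneg_left a1 hC
      have b2 := mul_le_mul_of_nonneg_left b1 hC
      have := norm_add_le (A i) (B i)
      simp only [consSeq]
      nlinarith

/-- Commutator estimate: `∂ʲ(p f) - p ∂ʲf` is controlled by one derivative less of `f`. -/
theorem exists_tower_commutator (n : ℕ) : ∃ C : ℝ, 0 ≤ C ∧ ∀ p f : ℕ → L2,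
    IsTower (n + 1) p → IsTower n f → ∃ P : ℕ → L2, IsTower n P ∧ P 0 = mulL2 (p 0) (f 0) ∧
      ∀ i ≤ n, ‖P i - mulL2 (p 0) (f i)‖
        ≤ C * towerNorm (n + 1) p * ∑ j ∈ Finset.range n, ‖f j‖ := by
  induction n with
  | zero =>
    refine ⟨0, le_rfl, fun p f hp _ => ⟨fun _ => mulL2 (p 0) (f 0), ?_, rfl, ?_⟩⟩
    · intro i hi; omega
    · intro i hi
      obtain rfl : i = 0 := by omega
      simp
  | succ n ih =>
    obtain ⟨C, hC, ih⟩ := ih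
    obtain ⟨C', hC', hprod⟩ := exists_tower_mulL2 n
    refine ⟨C' + C, by positivity, fun p f hp hf => ?_⟩
    obtain ⟨A, hA, hA0, hAb⟩ := hprod _ _ (hf.mono (Nat.le_succ n)) hp.shift
    obtain ⟨B, hB, hB0, hBb⟩ := ih _ _ (hp.mono (Nat.le_succ _)) hf.shift
    have hd : IsPeriodicWeakDeriv (mulL2 (p 0) (f 0)) (A 0 + B 0) := by
      rw [hA0, hB0, mulL2_comm (f 0)]
      exact (hp 0 (by omega)).mul (hf 0 (by omega))
    refine ⟨_, (hA.add hB).cons hd, rfl, ?_⟩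
    have n1 := towerNorm_nonneg (n + 1 + 1) p
    have n2 := towerNorm_nonneg n f
    rintro (_ | i) hi
    · simp only [consSeq]
      rw [sub_self, norm_zero]
      exact mul_nonneg (mul_nonneg (by positivity) n1) n2
    · have a := hAb i (by omega)
      have b := hBb i (by omega)
      have a1 : towerNorm n f * towerNorm (n + 1) (fun i => p (i + 1))
          ≤ towerNorm (n + 1 + 1) p * towerNorm n f := by
        rw [mul_comm]
        exact mul_le_mul_of_nonneg_right (towerNorm_shift_le _ p) n2
      have b0 : ∑ j ∈ Finset.range n, ‖f (j + 1)‖ ≤ towerNorm n f := by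
        rw [towerNorm, Finset.sum_range_succ']
        linarith [norm_nonneg (f 0)]
      have b1 : towerNorm (n + 1) p * ∑ j ∈ Finset.range n, ‖f (j + 1)‖
          ≤ towerNorm (n + 1 + 1) p * towerNorm n f :=
        mul_le_mul (towerNorm_mono (by omega) p) b0
          (Finset.sum_nonneg fun _ _ => norm_nonneg _) n1
      have a2 := mul_le_mul_of_nonneg_left a1 hC'
      have b2 := mul_le_mul_of_nonneg_left b1 hC
      have := norm_add_le (A i) (B i - mulL2 (p 0) (f (i + 1)))
      rw [← add_sub_assoc] at this
      have e : ∑ j ∈ Finset.range (n + 1), ‖f j‖ = towerNorm n f := rfl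
      rw [e]
      simp only [consSeq]
      nlinarith

/-- The transport term `∫ p y yₓ` costs no derivative of `y`. -/
theorem abs_inner_mulL2_deriv_le {p p' p'' y y' : L2} (hp : IsPeriodicWeakDeriv p p')
    (hp' : IsPeriodicWeakDeriv p' p'') (hy : IsPeriodicWeakDeriv y y') :
    |⟪mulL2 p y', y⟫| ≤ (‖p'‖ + ‖p''‖) * ‖y‖ ^ 2 := by
  have h1 := (hp.mul hy).inner_eq_neg hy
  rw [inner_add_left, real_inner_comm] at h1
  have e : ⟪y', mulL2 p y⟫ = ⟪mulL2 p y', y⟫ := by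
    rw [real_inner_comm, inner_mulL2 hp.memLp_top, inner_mulL2 hp.memLp_top]
    simp only [mul_right_comm]
  have h2 : |⟪mulL2 p' y, y⟫| ≤ 2 * (‖p'‖ + ‖p''‖) * ‖y‖ ^ 2 :=
    calc _ ≤ ‖mulL2 p' y‖ * ‖y‖ := abs_real_inner_le_norm _ _
      _ ≤ (2 * (‖p'‖ + ‖p''‖) * ‖y‖) * ‖y‖ :=
        mul_le_mul_of_nonneg_right (hp'.norm_mulL2_le y) (norm_nonneg _)
      _ = _ := by ring
  rw [e] at h1
  have h3 : ⟪mulL2 p y', y⟫ = -(1 / 2) * ⟪mulL2 p' y, y⟫ := by linarith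
  rw [h3, abs_mul]
  norm_num
  linarith

/-- The energy estimate for the linear term `(p y)ₓ` in `Hⁿ`. -/
theorem exists_tower_transport (n : ℕ) : ∃ C : ℝ, 0 ≤ C ∧ ∀ p y : ℕ → L2,
    IsTower (n + 2) p → IsTower (n + 1) y → ∃ P : ℕ → L2, IsTower n P ∧
      P 0 = mulL2 (p 0) (y 1) + mulL2 (p 1) (y 0) ∧
      ∀ i ≤ n, |⟪P i, y i⟫| ≤ C * towerNorm (n + 2) p * towerNorm n y ^ 2 := by
  obtain ⟨C, hC, hcomm⟩ := exists_tower_commutator n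
  obtain ⟨C', hC', hprod⟩ := exists_tower_mulL2 n
  refine ⟨C + C' + 1, by positivity, fun p y hp hy => ?_⟩
  obtain ⟨A, hA, hA0, hAb⟩ := hcomm _ _ (hp.mono (by omega)) hy.shift
  obtain ⟨B, hB, hB0, hBb⟩ := hprod _ _ (hy.mono (Nat.le_succ n)) hp.shift
  refine ⟨_, hA.add hB, by rw [hA0, hB0, mulL2_comm (y 0)], fun i hi => ?_⟩
  have n1 := towerNorm_nonneg (n + 2) p
  have n2 := towerNorm_nonneg n y
  have hyi := norm_le_towerNorm hi y
  have s0 : ∑ j ∈ Finset.range n, ‖y (j + 1)‖ ≤ towerNorm n y := by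
    rw [towerNorm, Finset.sum_range_succ']
    linarith [norm_nonneg (y 0)]
  have a : ‖A i - mulL2 (p 0) (y (i + 1))‖ ≤ C * (towerNorm (n + 2) p * towerNorm n y) := by
    refine (hAb i hi).trans ?_
    rw [mul_assoc]
    exact mul_le_mul_of_nonneg_left (mul_le_mul (towerNorm_mono (by omega) p) s0
      (Finset.sum_nonneg fun _ _ => norm_nonneg _) n1) hC
  have b : ‖B i‖ ≤ C' * (towerNorm (n + 2) p * towerNorm n y) := by
    refine (hBb i hi).trans ?_
    rw [mul_assoc, mul_comm (towerNorm n y)]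
    exact mul_le_mul_of_nonneg_left
      (mul_le_mul_of_nonneg_right (towerNorm_shift_le _ p) n2) hC'
  have c := abs_inner_mulL2_deriv_le (hp 0 (by omega)) (hp 1 (by omega)) (hy i (by omega))
  have c0 : ‖p (0 + 1)‖ + ‖p (1 + 1)‖ ≤ towerNorm (n + 2) p := by
    refine le_trans ?_ (towerNorm_mono (show 2 ≤ n + 2 by omega) p)
    simp only [towerNorm, Finset.sum_range_succ, Finset.sum_range_zero]
    linarith [norm_nonneg (p 0)]
  have c1 : (‖p (0 + 1)‖ + ‖p (1 + 1)‖) * ‖y i‖ ^ 2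
      ≤ towerNorm (n + 2) p * towerNorm n y ^ 2 :=
    mul_le_mul c0 (pow_le_pow_left₀ (norm_nonneg _) hyi 2) (by positivity) n1
  have a' : |⟪A i - mulL2 (p 0) (y (i + 1)), y i⟫|
      ≤ C * (towerNorm (n + 2) p * towerNorm n y) * towerNorm n y :=
    (abs_real_inner_le_norm _ _).trans
      (mul_le_mul a hyi (norm_nonneg _) (by positivity))
  have b' : |⟪B i, y i⟫| ≤ C' * (towerNorm (n + 2) p * towerNorm n y) * towerNorm n y :=
    (abs_real_inner_le_norm _ _).trans
      (mul_le_mul b hyi (norm_nonneg _) (by positivity))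
  have e : ⟪A i + B i, y i⟫ = ⟪A i - mulL2 (p 0) (y (i + 1)), y i⟫ + ⟪B i, y i⟫
      + ⟪mulL2 (p 0) (y (i + 1)), y i⟫ := by
    rw [inner_sub_left, inner_add_left]; ring
  rw [e]
  refine (abs_add_three _ _ _).trans ?_
  nlinarith

/-! ### Energy identities up to second order -/

theorem mulL2_add {f : L2} (hf : MemLp f ⊤ mu01) (g h : L2) :
    mulL2 f (g + h) = mulL2 f g + mulL2 f h := by
  refine Lp.ext ?_
  filter_upwards [coeFn_mulL2 hf g, coeFn_mulL2 hf h, coeFn_mulL2 hf (g + h),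
    Lp.coeFn_add g h, Lp.coeFn_add (mulL2 f g) (mulL2 f h)] with x h1 h2 h3 h4 h5
  simp only [h5, Pi.add_apply, h1, h2, h3, h4, mul_add]

theorem inner_mulL2_right_comm {f : L2} (hf : MemLp f ⊤ mu01) (g h : L2) :
    ⟪mulL2 f g, h⟫ = ⟪mulL2 f h, g⟫ := by
  rw [inner_mulL2 hf, inner_mulL2 hf]
  simp only [mul_right_comm]

theorem IsPeriodicWeakDeriv.inner_self_eq_zero {f f' : L2} (h : IsPeriodicWeakDeriv f f') :
    ⟪f, f'⟫ = 0 := by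
  have := h.inner_eq_neg h
  rw [real_inner_comm f f'] at this
  linarith

section EnergyIdentities

variable {z₀ z₁ z₂ z₃ w : L2} {α β lam k : ℝ}

theorem inner_mulL2_self_deriv (h0 : IsPeriodicWeakDeriv z₀ z₁) : ⟪mulL2 z₀ z₀, z₁⟫ = 0 := by
  have h1 := (h0.mul h0).inner_eq_neg h0
  rw [inner_add_left, mulL2_comm z₁ z₀, inner_mulL2_right_comm h0.memLp_top z₀ z₁] at h1
  rw [inner_mulL2_right_comm h0.memLp_top z₀ z₁]
  linarith

theorem energy_identity_zero (h0 : IsPeriodicWeakDeriv z₀ z₁) (h1 : IsPeriodicWeakDeriv z₁ z₂)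
    (h2 : IsPeriodicWeakDeriv z₂ z₃)
    (hw : w = -(α • z₃ + β • z₁ + lam • mulL2 z₀ z₁ + k • z₀)) :
    ⟪z₀, w⟫ = -k * ‖z₀‖ ^ 2 := by
  have e1 : ⟪z₀, z₃⟫ = 0 := by
    rw [h0.inner_eq_neg h2, h1.inner_self_eq_zero, neg_zero]
  have e2 := h0.inner_self_eq_zero
  have e3 : ⟪z₀, mulL2 z₀ z₁⟫ = 0 := by
    rw [real_inner_comm, inner_mulL2_right_comm h0.memLp_top, inner_mulL2_self_deriv h0]
  rw [hw]
  simp only [inner_neg_right, inner_add_right, inner_smul_right, e1, e2, e3,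
    real_inner_self_eq_norm_sq]
  ring

/-- The left side is the time derivative of the Hamiltonian `α ‖zₓ‖² - (λ/3) ∫ z³`, when `w` is the
time derivative of `z`; only the damping term changes it. -/
theorem energy_identity_one (h0 : IsPeriodicWeakDeriv z₀ z₁) (h1 : IsPeriodicWeakDeriv z₁ z₂)
    (h2 : IsPeriodicWeakDeriv z₂ z₃)
    (hw : w = -(α • z₃ + β • z₁ + lam • mulL2 z₀ z₁ + k • z₀)) :
    -2 * α * ⟪w, z₂⟫ - lam * ⟪w, mulL2 z₀ z₀⟫
      = -2 * k * (α * ‖z₁‖ ^ 2 - lam / 3 * ⟪mulL2 z₀ z₀, z₀⟫)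
        + k * lam / 3 * ⟪mulL2 z₀ z₀, z₀⟫ := by
  have e1 := h2.inner_self_eq_zero
  have e2 := h1.inner_self_eq_zero
  have e3 : ⟪z₀, z₂⟫ = -‖z₁‖ ^ 2 := by
    rw [h0.inner_eq_neg h1, real_inner_self_eq_norm_sq]
  have e4 : ⟪mulL2 z₀ z₀, z₃⟫ = -2 * ⟪mulL2 z₀ z₁, z₂⟫ := by
    rw [(h0.mul h0).inner_eq_neg h2, inner_add_left, mulL2_comm z₁ z₀]; ring
  have e5 := inner_mulL2_self_deriv h0
  have e6 : ⟪mulL2 z₀ z₀, mulL2 z₀ z₁⟫ = 0 := by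
    have := (h0.mul h0).inner_self_eq_zero
    rw [inner_add_right, mulL2_comm z₁ z₀] at this
    linarith
  rw [real_inner_comm] at e1 e4 e5 e6
  rw [hw]
  simp only [inner_neg_left, inner_add_left, inner_smul_left, RCLike.conj_to_real, e1, e2, e3,
    e4, e5, e6, real_inner_comm (mulL2 z₀ z₀) z₀]
  ring

/-- The left side is the time derivative of `α ‖zₓₓ‖² - (5/3) λ ∫ z zₓ²`. The derivative of `‖zₓₓ‖²`
contains `-5 λ ∫ zₓ zₓₓ²` and that of `∫ z zₓ²` contains `-3 α ∫ zₓ zₓₓ²`; the coefficient `5/3`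
cancels them. The remaining quartic term is of lower order and needs no correction. -/
theorem energy_identity_two (h0 : IsPeriodicWeakDeriv z₀ z₁) (h1 : IsPeriodicWeakDeriv z₁ z₂)
    (h2 : IsPeriodicWeakDeriv z₂ z₃)
    (hw : w = -(α • z₃ + β • z₁ + lam • mulL2 z₀ z₁ + k • z₀)) :
    α * (-2 * ⟪-(β • z₂ + lam • (mulL2 z₁ z₁ + mulL2 z₀ z₂) + k • z₁), z₃⟫)
      - 5 / 3 * lam * (-⟪w, mulL2 z₁ z₁ + (mulL2 z₀ z₂ + mulL2 z₀ z₂)⟫)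
      = -2 * k * (α * ‖z₂‖ ^ 2 - 5 / 3 * lam * ⟪mulL2 z₁ z₁, z₀⟫)
        + (5 / 3 * k * lam * ⟪mulL2 z₁ z₁, z₀⟫
          + 5 / 3 * lam ^ 2 * ⟪mulL2 z₁ z₁, mulL2 z₀ z₁⟫) := by
  have e1 := h2.inner_self_eq_zero
  have e3 : ⟪z₁, z₃⟫ = -‖z₂‖ ^ 2 := by
    rw [h1.inner_eq_neg h2, real_inner_self_eq_norm_sq]
  have e4 : ⟪mulL2 z₁ z₁, z₃⟫ = -2 * ⟪mulL2 z₁ z₂, z₂⟫ := by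
    rw [(h1.mul h1).inner_eq_neg h2, inner_add_left, mulL2_comm z₂ z₁]; ring
  have e5 : ⟪mulL2 z₀ z₂, z₃⟫ = -1 / 2 * ⟪mulL2 z₁ z₂, z₂⟫ := by
    have := (h0.mul h2).inner_eq_neg h2
    rw [inner_add_left, inner_mulL2_right_comm h0.memLp_top z₃ z₂] at this
    linarith
  have e6 : ⟪mulL2 z₁ z₁, z₁⟫ = -2 * ⟪mulL2 z₀ z₂, z₁⟫ := by
    have := (h0.mul h1).inner_eq_neg h1
    rw [inner_add_left, inner_mulL2_right_comm h0.memLp_top z₁ z₂] at this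
    linarith
  have e7 : ⟪mulL2 z₀ z₂, mulL2 z₀ z₁⟫ = -⟪mulL2 z₁ z₁, mulL2 z₀ z₁⟫ := by
    have := (h0.mul h1).inner_self_eq_zero
    rw [inner_add_right, real_inner_comm, real_inner_comm (mulL2 z₀ z₂)] at this
    linarith
  have e8 : ⟪mulL2 z₀ z₂, z₀⟫ = -2 * ⟪mulL2 z₁ z₁, z₀⟫ := by
    rw [inner_mulL2_right_comm h0.memLp_top z₂ z₀, (h0.mul h0).inner_eq_neg h1, inner_add_left,
      mulL2_comm z₁ z₀, inner_mulL2_right_comm h0.memLp_top z₁ z₁, mulL2_comm z₀ z₁,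
      inner_mulL2_right_comm h1.memLp_top z₀ z₁]
    rw [inner_mulL2_right_comm h1.memLp_top z₁ z₀]
    ring
  rw [real_inner_comm (mulL2 z₁ z₁ + (mulL2 z₀ z₂ + mulL2 z₀ z₂)) w, hw]
  simp only [inner_neg_left, inner_neg_right, inner_add_left, inner_add_right, inner_smul_left,
    inner_smul_right, RCLike.conj_to_real, e1, e3, e4, e5, e6, e7, e8]
  ring

end EnergyIdentities

/-- Differentiability of a functional that is polynomial in derivatives of `z`, although only `z`
itself is differentiable in time: it suffices to write its increments as `⟪z s - z t, G s⟫`, moving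
all derivatives to `G` by parts. -/
theorem hasDerivWithinAt_of_sub_eq_inner {z G : ℝ → L2} {Φ : ℝ → ℝ} {S : Set ℝ} {t : ℝ} {z' g : L2}
    (hz : HasDerivWithinAt z z' S t) (hG : Tendsto G (𝓝[S] t) (𝓝 g))
    (h : ∀ s ∈ S, Φ s - Φ t = ⟪z s - z t, G s⟫) : HasDerivWithinAt Φ ⟪z', g⟫ S t := by
  rw [hasDerivWithinAt_iff_tendsto_slope] at hz ⊢
  refine (hz.inner (hG.mono_left (nhdsWithin_mono _ sdiff_subset))).congr' ?_
  filter_upwards [self_mem_nhdsWithin] with s hs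
  rw [slope_def_module, slope_def_module, h s hs.1, real_inner_smul_left, smul_eq_mul]

/-- Multiplication is continuous from `H¹ × L²` to `L²`. -/
theorem tendsto_mulL2 {f f' g : ℝ → L2} {f₀ f₀' g₀ : L2} {l : Filter ℝ}
    (hf : Tendsto f l (𝓝 f₀)) (hf' : Tendsto f' l (𝓝 f₀')) (hg : Tendsto g l (𝓝 g₀))
    (h : ∀ᶠ s in l, IsPeriodicWeakDeriv (f s) (f' s)) (h₀ : IsPeriodicWeakDeriv f₀ f₀') :
    Tendsto (fun s => mulL2 (f s) (g s)) l (𝓝 (mulL2 f₀ g₀)) := by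
  rw [tendsto_iff_norm_sub_tendsto_zero]
  have hb : Tendsto (fun s => 2 * (‖f s - f₀‖ + ‖f' s - f₀'‖) * ‖g s‖
      + 2 * (‖f₀‖ + ‖f₀'‖) * ‖g s - g₀‖) l (𝓝 0) := by
    have a := (tendsto_iff_norm_sub_tendsto_zero.1 hf)
    have b := (tendsto_iff_norm_sub_tendsto_zero.1 hf')
    have c := (tendsto_iff_norm_sub_tendsto_zero.1 hg)
    simpa using (((a.add b).const_mul 2).mul hg.norm).add (c.const_mul (2 * (‖f₀‖ + ‖f₀'‖)))
  refine squeeze_zero' (Eventually.of_forall fun _ => norm_nonneg _) ?_ hb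
  filter_upwards [h] with s hs
  rw [mulL2_sub_sub hs.memLp_top h₀.memLp_top]
  have hd : IsPeriodicWeakDeriv (f s - f₀) (f' s - f₀') := by
    have := hs.add (h₀.smul (-1))
    simpa [sub_eq_add_neg] using this
  exact (norm_add_le _ _).trans (add_le_add (hd.norm_mulL2_le _) (h₀.norm_mulL2_le _))

theorem IsPeriodicWeakDeriv.sub {f f' g g' : L2} (hf : IsPeriodicWeakDeriv f f')
    (hg : IsPeriodicWeakDeriv g g') : IsPeriodicWeakDeriv (f - g) (f' - g') := by
  simpa [sub_eq_add_neg] using hf.add (hg.smul (-1))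

section TimeDerivatives

variable {z₀ z₁ z₂ : ℝ → L2} {S : Set ℝ} {t : ℝ} {z' : L2}

theorem hasDerivWithinAt_norm_sq_deriv (ht : t ∈ S)
    (h0 : ∀ s ∈ S, IsPeriodicWeakDeriv (z₀ s) (z₁ s))
    (h1 : ∀ s ∈ S, IsPeriodicWeakDeriv (z₁ s) (z₂ s)) (c2 : ContinuousWithinAt z₂ S t)
    (hz : HasDerivWithinAt z₀ z' S t) :
    HasDerivWithinAt (fun s => ‖z₁ s‖ ^ 2) (-2 * ⟪z', z₂ t⟫) S t := by
  have hG : Tendsto (fun s => -(z₂ s + z₂ t)) (𝓝[S] t) (𝓝 (-(z₂ t + z₂ t))) :=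
    (c2.add continuousWithinAt_const).neg
  have := hasDerivWithinAt_of_sub_eq_inner (Φ := fun s => ‖z₁ s‖ ^ 2) hz hG fun s hs => by
    have e := ((h0 s hs).sub (h0 t ht)).inner_eq_neg ((h1 s hs).add (h1 t ht))
    rw [inner_neg_right, e, neg_neg, inner_sub_left, inner_add_right, inner_add_right,
      real_inner_self_eq_norm_sq, real_inner_self_eq_norm_sq, real_inner_comm (z₁ s) (z₁ t)]
    ring
  convert! this using 1
  rw [inner_neg_right, inner_add_right]; ring

theorem hasDerivWithinAt_cube (ht : t ∈ S) (h0 : ∀ s ∈ S, IsPeriodicWeakDeriv (z₀ s) (z₁ s))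
    (c0 : ContinuousWithinAt z₀ S t) (c1 : ContinuousWithinAt z₁ S t)
    (hz : HasDerivWithinAt z₀ z' S t) :
    HasDerivWithinAt (fun s => ⟪mulL2 (z₀ s) (z₀ s), z₀ s⟫)
      (3 * ⟪z', mulL2 (z₀ t) (z₀ t)⟫) S t := by
  have hev : ∀ᶠ s in 𝓝[S] t, IsPeriodicWeakDeriv (z₀ s) (z₁ s) := by
    filter_upwards [self_mem_nhdsWithin] with s hs using h0 s hs
  have hG := ((tendsto_mulL2 c0 c1 c0 hev (h0 t ht)).add
    (tendsto_mulL2 c0 c1 (tendsto_const_nhds (x := z₀ t)) hev (h0 t ht))).add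
    (tendsto_const_nhds (x := mulL2 (z₀ t) (z₀ t)))
  have := hasDerivWithinAt_of_sub_eq_inner (Φ := fun s => ⟪mulL2 (z₀ s) (z₀ s), z₀ s⟫) hz hG
    fun s hs => by
    have a := (h0 s hs).memLp_top
    have b := (h0 t ht).memLp_top
    have e1 : ⟪z₀ s, mulL2 (z₀ s) (z₀ t)⟫ = ⟪mulL2 (z₀ s) (z₀ s), z₀ t⟫ := by
      rw [real_inner_comm, inner_mulL2_right_comm a]
    have e2 : ⟪z₀ t, mulL2 (z₀ s) (z₀ t)⟫ = ⟪mulL2 (z₀ t) (z₀ t), z₀ s⟫ := by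
      rw [real_inner_comm, mulL2_comm, inner_mulL2_right_comm b]
    simp only [inner_sub_left, inner_add_right, e1, e2]
    rw [real_inner_comm (mulL2 (z₀ s) (z₀ s)) (z₀ s), real_inner_comm (mulL2 (z₀ s) (z₀ s)) (z₀ t),
      real_inner_comm (mulL2 (z₀ t) (z₀ t)) (z₀ s), real_inner_comm (mulL2 (z₀ t) (z₀ t)) (z₀ t)]
    ring
  convert! this using 1
  rw [inner_add_right, inner_add_right]; ring

theorem hasDerivWithinAt_mul_deriv_sq (ht : t ∈ S)
    (h0 : ∀ s ∈ S, IsPeriodicWeakDeriv (z₀ s) (z₁ s))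
    (h1 : ∀ s ∈ S, IsPeriodicWeakDeriv (z₁ s) (z₂ s))
    (c1 : ContinuousWithinAt z₁ S t)
    (c2 : ContinuousWithinAt z₂ S t) (hz : HasDerivWithinAt z₀ z' S t) :
    HasDerivWithinAt (fun s => ⟪mulL2 (z₁ s) (z₁ s), z₀ s⟫)
      (-⟪z', mulL2 (z₁ t) (z₁ t) + (mulL2 (z₀ t) (z₂ t) + mulL2 (z₀ t) (z₂ t))⟫) S t := by
  have hev : ∀ᶠ s in 𝓝[S] t, IsPeriodicWeakDeriv (z₁ s) (z₂ s) := by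
    filter_upwards [self_mem_nhdsWithin] with s hs using h1 s hs
  have c1' : Tendsto (fun s => z₁ s + z₁ t) (𝓝[S] t) (𝓝 (z₁ t + z₁ t)) :=
    c1.add continuousWithinAt_const
  have c2' : Tendsto (fun s => z₂ s + z₂ t) (𝓝[S] t) (𝓝 (z₂ t + z₂ t)) :=
    c2.add continuousWithinAt_const
  have hG := (tendsto_mulL2 c1 c2 c1 hev (h1 t ht)).sub
    ((tendsto_mulL2 (tendsto_const_nhds (x := z₁ t)) (tendsto_const_nhds (x := z₂ t)) c1'
      (Eventually.of_forall fun _ => h1 t ht) (h1 t ht)).add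
    (tendsto_mulL2 (tendsto_const_nhds (x := z₀ t)) (tendsto_const_nhds (x := z₁ t)) c2'
      (Eventually.of_forall fun _ => h0 t ht) (h0 t ht)))
  have := hasDerivWithinAt_of_sub_eq_inner (Φ := fun s => ⟪mulL2 (z₁ s) (z₁ s), z₀ s⟫) hz hG
    fun s hs => by
    have b0 := (h0 t ht).memLp_top
    have a1 := (h1 s hs).memLp_top
    have b1 := (h1 t ht).memLp_top
    have e := ((h0 t ht).mul ((h1 s hs).add (h1 t ht))).inner_eq_neg ((h0 s hs).sub (h0 t ht))
    have f1 : ⟪mulL2 (z₀ t) (z₁ s + z₁ t), z₁ s - z₁ t⟫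
        = ⟪mulL2 (z₁ s) (z₁ s), z₀ t⟫ - ⟪mulL2 (z₁ t) (z₁ t), z₀ t⟫ := by
      rw [mulL2_add b0, inner_add_left, inner_sub_right, inner_sub_right,
        mulL2_comm (z₀ t) (z₁ s), mulL2_comm (z₀ t) (z₁ t), inner_mulL2_right_comm a1,
        inner_mulL2_right_comm a1 (z₀ t), inner_mulL2_right_comm b1 (z₀ t),
        inner_mulL2_right_comm b1 (z₀ t), mulL2_comm (z₁ t) (z₁ s)]
      ring
    rw [f1] at e
    rw [inner_sub_right, real_inner_comm _ (z₀ s - z₀ t), real_inner_comm _ (z₀ s - z₀ t),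
      inner_sub_right (mulL2 (z₁ s) (z₁ s))]
    linarith
  convert! this using 1
  rw [mulL2_add (h1 t ht).memLp_top, mulL2_add (h0 t ht).memLp_top, ← inner_neg_right]
  congr 1
  abel

end TimeDerivatives

/-! ### Time averages and the identity for the second derivative -/

/-- The forward time average `δ⁻¹ ∫_t^{t+δ} f`. -/
def timeAvg (δ : ℝ) (f : ℝ → L2) (t : ℝ) : L2 := δ⁻¹ • ∫ τ in t..t + δ, f τ

theorem hasDerivAt_timeAvg {f : ℝ → L2} (hf : Continuous f) (δ t : ℝ) :
    HasDerivAt (timeAvg δ f) (δ⁻¹ • (f (t + δ) - f t)) t := by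
  have h1 : ∀ s, HasDerivAt (fun s => ∫ τ in (0 : ℝ)..s, f τ) (f s) s := fun s =>
    intervalIntegral.integral_hasDerivAt_right (hf.intervalIntegrable _ _)
      (hf.stronglyMeasurableAtFilter _ _) hf.continuousAt
  have h2 : HasDerivAt (fun s => ∫ τ in (0 : ℝ)..s + δ, f τ) (f (t + δ)) t :=
    (h1 (t + δ)).comp_add_const t δ
  refine ((h2.sub (h1 t)).const_smul δ⁻¹).congr_of_eventuallyEq (Eventually.of_forall fun s => ?_)
  simp only [timeAvg, Pi.sub_apply, Pi.smul_apply]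
  rw [intervalIntegral.integral_interval_sub_left (hf.intervalIntegrable _ _)
    (hf.intervalIntegrable _ _)]

theorem continuous_timeAvg {f : ℝ → L2} (hf : Continuous f) (δ : ℝ) : Continuous (timeAvg δ f) :=
  continuous_iff_continuousAt.2 fun t => (hasDerivAt_timeAvg hf δ t).continuousAt

theorem tendsto_timeAvg {f : ℝ → L2} (hf : Continuous f) (t : ℝ) :
    Tendsto (fun δ => timeAvg δ f t) (𝓝[>] 0) (𝓝 (f t)) := by
  have h1 : HasDerivAt (fun s => ∫ τ in t..s, f τ) (f t) t :=
    intervalIntegral.integral_hasDerivAt_right (hf.intervalIntegrable _ _)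
      (hf.stronglyMeasurableAtFilter _ _) hf.continuousAt
  have := h1.tendsto_slope_zero_right
  simpa [timeAvg] using this

theorem norm_timeAvg_le {f : ℝ → L2} {δ t M : ℝ} (hδ : 0 < δ)
    (h : ∀ τ ∈ Icc t (t + δ), ‖f τ‖ ≤ M) : ‖timeAvg δ f t‖ ≤ M := by
  have := intervalIntegral.norm_integral_le_of_norm_le_const (f := f) (a := t) (b := t + δ) (C := M)
    fun τ hτ => by
      rw [uIoc_of_le (by linarith)] at hτ
      exact h τ (Ioc_subset_Icc_self hτ)
  rw [timeAvg, norm_smul, norm_inv, Real.norm_of_nonneg hδ.le, inv_mul_le_iff₀ hδ]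
  rw [add_sub_cancel_left, abs_of_pos hδ] at this
  linarith

theorem inner_intervalIntegral {f : ℝ → L2} (hf : Continuous f) (c : L2) (a b : ℝ) :
    ⟪c, ∫ τ in a..b, f τ⟫ = ∫ τ in a..b, ⟪c, f τ⟫ :=
  ((innerSL ℝ c).intervalIntegral_comp_comm (hf.intervalIntegrable a b)).symm

theorem isPeriodicWeakDeriv_iff_inner {f g : L2} : IsPeriodicWeakDeriv f g ↔
    ∀ θ (hθ : IsPeriodicTest θ), ⟪((memLp_top_of_continuous hθ.continuous_deriv).mono_exponent
      (q := ⊤) (p := 2) le_top).toLp, f⟫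
        = -⟪((memLp_top_of_continuous hθ.smooth.continuous).mono_exponent
      (q := ⊤) (p := 2) le_top).toLp, g⟫ := by
  refine forall_congr' fun θ => forall_congr' fun hθ => ?_
  rw [real_inner_L2, real_inner_L2]
  have e1 : ∀ (η : ℝ → ℝ) (hη : MemLp η 2 mu01) (f : L2),
      ∫ x, hη.toLp _ x * f x ∂mu01 = ∫ x, f x * η x ∂mu01 := by
    intro η hη f
    apply integral_congr_ae
    filter_upwards [hη.coeFn_toLp] with x hx using by rw [hx, mul_comm]
  rw [e1, e1]

theorem IsPeriodicWeakDeriv.timeAvg {f g : ℝ → L2} (hf : Continuous f) (hg : Continuous g)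
    (h : ∀ t, IsPeriodicWeakDeriv (f t) (g t)) (δ t : ℝ) :
    IsPeriodicWeakDeriv (timeAvg δ f t) (timeAvg δ g t) := by
  refine IsPeriodicWeakDeriv.smul _ ?_
  rw [isPeriodicWeakDeriv_iff_inner]
  intro θ hθ
  rw [inner_intervalIntegral hf, inner_intervalIntegral hg, ← intervalIntegral.integral_neg]
  congr 1
  ext τ
  exact isPeriodicWeakDeriv_iff_inner.1 (h τ) θ hθ

section SecondDerivative

variable {z₀ z₁ z₂ z₃ g₀ g₁ w : ℝ → L2} {α : ℝ}

/-- For time averages the energy identity at second order needs no extra regularity. -/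
theorem hasDerivAt_norm_sq_timeAvg (hα : α ≠ 0)
    (c2 : Continuous z₂) (c3 : Continuous z₃) (cg0 : Continuous g₀) (cg1 : Continuous g₁)
    (h0 : ∀ t, IsPeriodicWeakDeriv (z₀ t) (z₁ t)) (h1 : ∀ t, IsPeriodicWeakDeriv (z₁ t) (z₂ t))
    (h2 : ∀ t, IsPeriodicWeakDeriv (z₂ t) (z₃ t)) (hg : ∀ t, IsPeriodicWeakDeriv (g₀ t) (g₁ t))
    (hz : ∀ t, 0 < t → HasDerivAt z₀ (-(α • z₃ t) + g₀ t) t) {δ t : ℝ} (hδ : 0 < δ) (ht : 0 < t) :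
    HasDerivAt (fun t => ‖timeAvg δ z₂ t‖ ^ 2) (-2 * ⟪timeAvg δ g₁ t, timeAvg δ z₃ t⟫) t := by
  have hd := (hasDerivAt_timeAvg c2 δ t).norm_sq
  convert! hd using 1
  set Z₂ := timeAvg δ z₂ t
  set Z₃ := timeAvg δ z₃ t
  set G₀ := timeAvg δ g₀ t
  set G₁ := timeAvg δ g₁ t
  set D₀ := δ⁻¹ • (z₀ (t + δ) - z₀ t) with hD₀
  set D₁ := δ⁻¹ • (z₁ (t + δ) - z₁ t) with hD₁
  set D₂ := δ⁻¹ • (z₂ (t + δ) - z₂ t) with hD₂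
  have hZ : IsPeriodicWeakDeriv Z₂ Z₃ := IsPeriodicWeakDeriv.timeAvg c2 c3 h2 δ t
  have hG : IsPeriodicWeakDeriv G₀ G₁ := IsPeriodicWeakDeriv.timeAvg cg0 cg1 hg δ t
  have hD : IsPeriodicWeakDeriv D₀ D₁ := ((h0 _).sub (h0 _)).smul _
  have hD' : IsPeriodicWeakDeriv D₁ D₂ := ((h1 _).sub (h1 _)).smul _
  have heq : D₀ = -(α • Z₃) + G₀ := by
    have : ∫ τ in t..t + δ, (-(α • z₃ τ) + g₀ τ) = z₀ (t + δ) - z₀ t :=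
      intervalIntegral.integral_eq_sub_of_hasDerivAt (fun τ hτ => by
        rw [uIcc_of_le (by linarith)] at hτ
        exact hz τ (ht.trans_le hτ.1)) (((c3.const_smul α).neg.add cg0).intervalIntegrable _ _)
    have i3 : IntervalIntegrable (fun τ => -(α • z₃ τ)) volume t (t + δ) :=
      (c3.const_smul α).neg.intervalIntegrable _ _
    rw [intervalIntegral.integral_add i3 (cg0.intervalIntegrable _ _),
      intervalIntegral.integral_neg, intervalIntegral.integral_smul] at this
    rw [hD₀, ← this, smul_add, smul_neg, smul_comm]
    rfl
  clear_value D₀ D₁ D₂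
  -- `α ⟪Z₂, D₂⟫ = -α ⟪Z₃, D₁⟫ = ⟪D₀ - G₀, D₁⟫ = -⟪G₀, D₁⟫ = ⟪G₁, D₀⟫ = -α ⟪G₁, Z₃⟫`
  have a1 := hD'.inner_eq_neg hZ
  have a2 := hD.inner_self_eq_zero
  have a3 := hG.inner_eq_neg hD
  have a4 := hG.inner_self_eq_zero
  rw [real_inner_comm] at a4
  rw [heq, inner_add_left, inner_neg_left, real_inner_smul_left, real_inner_comm D₁ Z₃] at a2
  rw [heq, inner_add_right, inner_neg_right, real_inner_smul_right, a4] at a3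
  rw [real_inner_comm D₂ Z₂]
  have : α * (⟪G₁, Z₃⟫ + ⟪D₂, Z₂⟫) = 0 := by linear_combination a2 - a3 + α * a1
  have := (mul_eq_zero.1 this).resolve_left hα
  linarith

/-- The identity for time averages, integrated in time, passes to the limit of small averages. -/
theorem hasDerivAt_norm_sq_second (hα : α ≠ 0)
    (c2 : Continuous z₂) (c3 : Continuous z₃) (cg0 : Continuous g₀) (cg1 : Continuous g₁)
    (h0 : ∀ t, IsPeriodicWeakDeriv (z₀ t) (z₁ t)) (h1 : ∀ t, IsPeriodicWeakDeriv (z₁ t) (z₂ t))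
    (h2 : ∀ t, IsPeriodicWeakDeriv (z₂ t) (z₃ t)) (hg : ∀ t, IsPeriodicWeakDeriv (g₀ t) (g₁ t))
    (hz : ∀ t, 0 < t → HasDerivAt z₀ (-(α • z₃ t) + g₀ t) t) {t : ℝ} (ht : 0 < t) :
    HasDerivAt (fun t => ‖z₂ t‖ ^ 2) (-2 * ⟪g₁ t, z₃ t⟫) t := by
  have cφ : Continuous fun t => -2 * ⟪g₁ t, z₃ t⟫ := (cg1.inner c3).const_mul _
  have key : ∀ b, t / 2 ≤ b →
      ‖z₂ b‖ ^ 2 - ‖z₂ (t / 2)‖ ^ 2 = ∫ τ in t / 2..b, -2 * ⟪g₁ τ, z₃ τ⟫ := by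
    intro b hb
    have hδ : Tendsto (fun n : ℕ => 1 / ((n : ℝ) + 1)) atTop (𝓝[>] 0) :=
      tendsto_nhdsWithin_iff.2 ⟨tendsto_one_div_add_atTop_nhds_zero_nat,
        Eventually.of_forall fun n => by
          have : 0 < 1 / ((n : ℝ) + 1) := by positivity
          exact this⟩
    have lim : ∀ {f : ℝ → L2}, Continuous f → ∀ s,
        Tendsto (fun n : ℕ => timeAvg (1 / ((n : ℝ) + 1)) f s) atTop (𝓝 (f s)) :=
      fun hf s => (tendsto_timeAvg hf s).comp hδ
    have l1 := ((lim c2 b).norm.pow 2).sub ((lim c2 (t / 2)).norm.pow 2)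
    obtain ⟨M, hM⟩ := (isCompact_Icc (a := t / 2) (b := b + 1)).exists_bound_of_continuousOn
      cg1.continuousOn
    obtain ⟨N, hN⟩ := (isCompact_Icc (a := t / 2) (b := b + 1)).exists_bound_of_continuousOn
      c3.continuousOn
    have hc : ∀ n : ℕ, Continuous fun τ =>
        -2 * ⟪timeAvg (1 / ((n : ℝ) + 1)) g₁ τ, timeAvg (1 / ((n : ℝ) + 1)) z₃ τ⟫ := fun n =>
      ((continuous_timeAvg cg1 _).inner (continuous_timeAvg c3 _)).const_mul _
    have l2 : Tendsto (fun n : ℕ => ∫ τ in t / 2..b,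
        -2 * ⟪timeAvg (1 / ((n : ℝ) + 1)) g₁ τ, timeAvg (1 / ((n : ℝ) + 1)) z₃ τ⟫) atTop
        (𝓝 (∫ τ in t / 2..b, -2 * ⟪g₁ τ, z₃ τ⟫)) := by
      refine intervalIntegral.tendsto_integral_filter_of_dominated_convergence
        (fun _ => 2 * (M * N)) (Eventually.of_forall fun n => ?_)
        (Eventually.of_forall fun n => Eventually.of_forall fun τ hτ => ?_)
        (by simp) (Eventually.of_forall fun τ _ => ((lim cg1 τ).inner (lim c3 τ)).const_mul _)
      · exact (hc n).aestronglyMeasurable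
      · rw [uIoc_of_le hb] at hτ
        have p : (0 : ℝ) < 1 / ((n : ℝ) + 1) := by positivity
        have p1 : 1 / ((n : ℝ) + 1) ≤ 1 := by
          rw [div_le_one (by positivity)]; linarith [(Nat.cast_nonneg n : (0 : ℝ) ≤ n)]
        have b1 : ‖timeAvg (1 / ((n : ℝ) + 1)) g₁ τ‖ ≤ M := norm_timeAvg_le p fun σ hσ =>
          hM σ ⟨hτ.1.le.trans hσ.1, hσ.2.trans (add_le_add hτ.2 p1)⟩
        have b2 : ‖timeAvg (1 / ((n : ℝ) + 1)) z₃ τ‖ ≤ N := norm_timeAvg_le p fun σ hσ =>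
          hN σ ⟨hτ.1.le.trans hσ.1, hσ.2.trans (add_le_add hτ.2 p1)⟩
        rw [norm_mul, Real.norm_eq_abs, Real.norm_eq_abs]
        have := (abs_real_inner_le_norm (timeAvg (1 / ((n : ℝ) + 1)) g₁ τ)
          (timeAvg (1 / ((n : ℝ) + 1)) z₃ τ)).trans (mul_le_mul b1 b2 (norm_nonneg _)
          ((norm_nonneg _).trans b1))
        rw [show |(-2 : ℝ)| = 2 by norm_num]
        linarith
    refine tendsto_nhds_unique (l1.congr fun n => ?_) l2
    symm
    refine intervalIntegral.integral_eq_sub_of_hasDerivAt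
      (f := fun s => ‖timeAvg (1 / ((n : ℝ) + 1)) z₂ s‖ ^ 2) (fun τ hτ => ?_)
      ((hc n).intervalIntegrable _ _)
    rw [uIcc_of_le hb] at hτ
    exact hasDerivAt_norm_sq_timeAvg hα c2 c3 cg0 cg1 h0 h1 h2 hg hz (by positivity)
      (lt_of_lt_of_le (by linarith) hτ.1)
  have hI : HasDerivAt (fun b => ∫ τ in t / 2..b, -2 * ⟪g₁ τ, z₃ τ⟫) (-2 * ⟪g₁ t, z₃ t⟫) t :=
    intervalIntegral.integral_hasDerivAt_right (cφ.intervalIntegrable _ _)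
      (cφ.stronglyMeasurableAtFilter _ _) cφ.continuousAt
  refine (hI.add_const (‖z₂ (t / 2)‖ ^ 2)).congr_of_eventuallyEq ?_
  filter_upwards [Ici_mem_nhds (show t / 2 < t by linarith)] with b hb
  rw [← key b hb]; ring

end SecondDerivative

/-! ### Decay of energies; the scalar equation at orders zero and one -/

/-- A Gronwall inequality with integrable rate `M e^{-kt}`, after factoring out `e^{-2kt}`. -/
theorem gronwall_exp_decay {k M c : ℝ} (hk : 0 < k) (hM : 0 ≤ M) (hc : 0 ≤ c) {E E' : ℝ → ℝ}
    (hE : ContinuousOn E (Ici 0)) (hE' : ∀ t, 0 < t → HasDerivAt E (E' t) t)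
    (h : ∀ t, 0 < t → E' t + 2 * k * E t
      ≤ M * Real.exp (-k * t) * (E t + c * Real.exp (-k * t) ^ 2)) :
    ∀ t, 0 ≤ t → E t ≤ |E 0 + c| * Real.exp (M / k) * Real.exp (-k * t) ^ 2 := by
  -- `exp (M/k e^{-kt})` is an integrating factor for the rate `M e^{-kt}`.
  set g : ℝ → ℝ := fun t => (Real.exp (2 * k * t) * E t + c) * Real.exp (M / k * Real.exp (-k * t))
  have hanti : AntitoneOn g (Ici 0) := by
    refine antitoneOn_of_hasDerivWithinAt_nonpos (convex_Ici 0) ?_ (f' := fun t =>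
      Real.exp (2 * k * t) * Real.exp (M / k * Real.exp (-k * t)) * (E' t + 2 * k * E t
      - M * Real.exp (-k * t) * (E t + c * Real.exp (-k * t) ^ 2))) ?_ ?_
    · exact (((by fun_prop : Continuous fun t => Real.exp (2 * k * t)).continuousOn.mul
        hE).add continuousOn_const).mul (by fun_prop)
    · intro t ht
      rw [interior_Ici] at ht
      have d1 : HasDerivAt (fun t => Real.exp (2 * k * t)) (Real.exp (2 * k * t) * (2 * k)) t := by
        simpa using ((hasDerivAt_id t).const_mul (2 * k)).exp
      have d2 : HasDerivAt (fun t => Real.exp (-k * t)) (Real.exp (-k * t) * (-k)) t := by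
        simpa using ((hasDerivAt_id t).const_mul (-k)).exp
      have d := ((d1.mul (hE' t ht)).add_const c).mul (d2.const_mul (M / k)).exp
      refine (d.congr_deriv ?_).hasDerivWithinAt
      have e : Real.exp (2 * k * t) * Real.exp (-k * t) ^ 2 = 1 := by
        rw [← Real.exp_nat_mul, ← Real.exp_add]
        simp only [Nat.cast_ofNat]
        rw [show 2 * k * t + 2 * (-k * t) = 0 by ring, Real.exp_zero]
      have e2 : M / k * k = M := div_mul_cancel₀ M hk.ne'
      simp only [Pi.mul_apply]
      linear_combination (-Real.exp (M / k * Real.exp (-k * t)) * Real.exp (-k * t)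
        * (Real.exp (2 * k * t) * E t + c)) * e2
        + (c * M * Real.exp (M / k * Real.exp (-k * t)) * Real.exp (-k * t)) * e
    · intro t ht
      rw [interior_Ici] at ht
      have := h t ht
      exact mul_nonpos_of_nonneg_of_nonpos (by positivity) (by linarith)
  intro t ht
  have h1 : g t ≤ g 0 := hanti self_mem_Ici ht ht
  simp only [g, mul_zero, Real.exp_zero, one_mul, mul_one] at h1
  have h2 : Real.exp (2 * k * t) * E t + c ≤ |E 0 + c| * Real.exp (M / k) := by
    rcases le_or_gt (Real.exp (2 * k * t) * E t + c) 0 with hn | hp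
    · exact hn.trans (by positivity)
    · have : 1 ≤ Real.exp (M / k * Real.exp (-k * t)) := Real.one_le_exp (by positivity)
      calc _ ≤ (Real.exp (2 * k * t) * E t + c) * Real.exp (M / k * Real.exp (-k * t)) :=
            le_mul_of_one_le_right hp.le this
        _ ≤ (E 0 + c) * Real.exp (M / k) := h1
        _ ≤ _ := mul_le_mul_of_nonneg_right (le_abs_self _) (Real.exp_pos _).le
  have e : Real.exp (2 * k * t) * Real.exp (-k * t) ^ 2 = 1 := by
    rw [← Real.exp_nat_mul, ← Real.exp_add]
    simp only [Nat.cast_ofNat]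
    rw [show 2 * k * t + 2 * (-k * t) = 0 by ring, Real.exp_zero]
  have h3 := mul_le_mul_of_nonneg_right (show Real.exp (2 * k * t) * E t ≤
    |E 0 + c| * Real.exp (M / k) by linarith) (sq_nonneg (Real.exp (-k * t)))
  calc E t = Real.exp (2 * k * t) * E t * Real.exp (-k * t) ^ 2 := by
        linear_combination (-E t) * e
    _ ≤ _ := h3

theorem exp_neg_mul_le_one {k t : ℝ} (hk : 0 < k) (ht : 0 ≤ t) : Real.exp (-k * t) ≤ 1 :=
  Real.exp_le_one_iff.2 (by nlinarith)

/-- Exponential decay from an energy that is coercive, and dissipated, up to errors of higher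
order in the decaying quantities. -/
theorem exists_decay_of_energy {k a m : ℝ} (hk : 0 < k) (ha : 0 < a) (hm : 0 ≤ m)
    {E E' x : ℝ → ℝ} (hE : ContinuousOn E (Ici 0)) (hE' : ∀ t, 0 < t → HasDerivAt E (E' t) t)
    (h1 : ∀ t, 0 ≤ t → a * x t ^ 2 - E t
      ≤ m * Real.exp (-k * t) ^ 2 * (Real.exp (-k * t) + x t))
    (h2 : ∀ t, 0 < t → E' t + 2 * k * E t
      ≤ m * Real.exp (-k * t) ^ 2 * (Real.exp (-k * t) + x t)) :
    ∃ K, 0 ≤ K ∧ ∀ t, 0 ≤ t → x t ≤ K * Real.exp (-k * t) := by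
  -- The term `m ε² x`, with `ε = e^{-kt}`, is absorbed in `a x² / 2` by Young's inequality.
  set c₁ := m + m ^ 2 / (2 * a) with hc₁
  have hc₁0 : 0 ≤ c₁ := by positivity
  have coer : ∀ t, 0 ≤ t → a * x t ^ 2 / 2 ≤ E t + c₁ * Real.exp (-k * t) ^ 2 := by
    intro t ht
    have h := h1 t ht
    have e1 := exp_neg_mul_le_one hk ht
    have e0 := Real.exp_pos (-k * t)
    set ε := Real.exp (-k * t)
    have hy : m * ε ^ 2 * x t ≤ a * x t ^ 2 / 2 + m ^ 2 / (2 * a) * ε ^ 4 := by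
      have : a * x t ^ 2 / 2 + m ^ 2 / (2 * a) * ε ^ 4 - m * ε ^ 2 * x t
          = (a * x t - m * ε ^ 2) ^ 2 / (2 * a) := by field_simp; ring
      have : 0 ≤ (a * x t - m * ε ^ 2) ^ 2 / (2 * a) := by positivity
      linarith
    have h3 : ε ^ 3 ≤ ε ^ 2 := pow_le_pow_of_le_one e0.le e1 (by norm_num)
    have h4 : ε ^ 4 ≤ ε ^ 2 := pow_le_pow_of_le_one e0.le e1 (by norm_num)
    have h3' := mul_le_mul_of_nonneg_left h3 hm
    have h4' := mul_le_mul_of_nonneg_left h4 (show 0 ≤ m ^ 2 / (2 * a) by positivity)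
    rw [hc₁]
    nlinarith
  have hg := gronwall_exp_decay (c := c₁ + 3 * a / 2) (M := m / a) hk (by positivity)
    (by positivity) hE hE' fun t ht => by
      refine (h2 t ht).trans ?_
      have h := coer t ht.le
      have e0 := Real.exp_pos (-k * t)
      set ε := Real.exp (-k * t)
      have s1 : ε * (ε + x t) ≤ 3 / 2 * ε ^ 2 + x t ^ 2 / 2 := by
        nlinarith [sq_nonneg (ε - x t)]
      have s2 : a * (ε * (ε + x t)) ≤ E t + (c₁ + 3 * a / 2) * ε ^ 2 := by nlinarith
      have s3 := mul_le_mul_of_nonneg_left s2 (show 0 ≤ m / a * ε by positivity)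
      calc m * ε ^ 2 * (ε + x t) = m / a * ε * (a * (ε * (ε + x t))) := by field_simp
        _ ≤ _ := s3
  set L := |E 0 + (c₁ + 3 * a / 2)| * Real.exp (m / a / k)
  have hL : 0 ≤ L := by positivity
  refine ⟨Real.sqrt (2 * (L + c₁) / a), Real.sqrt_nonneg _, fun t ht => ?_⟩
  have e0 := Real.exp_pos (-k * t)
  refine abs_le_of_sq_le_sq' ?_ (by positivity) |>.2
  rw [mul_pow, Real.sq_sqrt (by positivity)]
  have := coer t ht
  have := hg t ht
  rw [div_mul_eq_mul_div, le_div_iff₀ ha]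
  nlinarith

/-- `z` and `zt` list the spatial derivatives of a solution, and of its time derivative, of
`z' + α zₓₓₓ + β zₓ + λ z zₓ + k z = 0` in `C([0,∞); H^{r+3}) ∩ C¹([0,∞); H^r)`. -/
structure IsDampedKdV (α β lam k : ℝ) (r : ℕ) (z zt : ℝ → ℕ → L2) : Prop where
  tower : ∀ t, 0 ≤ t → IsTower (r + 3) (z t)
  tower_deriv : ∀ t, 0 ≤ t → IsTower r (zt t)
  cont : ∀ j ≤ r + 3, ContinuousOn (fun t => z t j) (Ici 0)
  hasDeriv : ∀ j ≤ r, ∀ t, 0 ≤ t →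
    HasDerivWithinAt (fun τ => z τ j) (zt t j) (Ici 0) t
  eqn : ∀ t, 0 ≤ t →
    zt t 0 = -(α • z t 3 + β • z t 1 + lam • mulL2 (z t 0) (z t 1) + k • z t 0)

namespace IsDampedKdV

variable {α β lam k : ℝ} {r : ℕ} {z zt : ℝ → ℕ → L2}

theorem decay_zero (h : IsDampedKdV α β lam k r z zt) (hk : 0 < k) :
    ∃ K, 0 ≤ K ∧ ∀ t, 0 ≤ t → ‖z t 0‖ ≤ K * Real.exp (-k * t) := by
  refine exists_decay_of_energy (a := 1) (m := 0) hk one_pos le_rfl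
    (E := fun t => ‖z t 0‖ ^ 2) (E' := fun t => 2 * ⟪z t 0, zt t 0⟫)
    ((h.cont 0 (by omega)).norm.pow 2) (fun t ht => ?_) (fun t ht => by simp) (fun t ht => ?_)
  · exact ((h.hasDeriv 0 (by omega) t ht.le).hasDerivAt (Ici_mem_nhds ht)).norm_sq
  · have T := h.tower t ht.le
    rw [energy_identity_zero (T 0 (by omega)) (T 1 (by omega)) (T 2 (by omega)) (h.eqn t ht.le)]
    apply le_of_eq
    ring

theorem decay_one (h : IsDampedKdV α β lam k r z zt) (hα : 0 < α) (hk : 0 < k) :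
    ∃ K, 0 ≤ K ∧ ∀ t, 0 ≤ t → ‖z t 1‖ ≤ K * Real.exp (-k * t) := by
  obtain ⟨K, hK, hz0⟩ := h.decay_zero hk
  have hd : ∀ t, 0 ≤ t → HasDerivWithinAt
      (fun t => α * ‖z t 1‖ ^ 2 - lam / 3 * ⟪mulL2 (z t 0) (z t 0), z t 0⟫)
      (-2 * α * ⟪zt t 0, z t 2⟫ - lam * ⟪zt t 0, mulL2 (z t 0) (z t 0)⟫) (Ici 0) t := by
    intro t ht
    have d1 := hasDerivWithinAt_norm_sq_deriv ht (fun s hs => h.tower s hs 0 (by omega))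
      (fun s hs => h.tower s hs 1 (by omega)) (h.cont 2 (by omega) t ht)
      (h.hasDeriv 0 (by omega) t ht)
    have d2 := hasDerivWithinAt_cube ht (fun s hs => h.tower s hs 0 (by omega))
      (h.cont 0 (by omega) t ht) (h.cont 1 (by omega) t ht) (h.hasDeriv 0 (by omega) t ht)
    exact ((d1.const_mul α).sub (d2.const_mul (lam / 3))).congr_deriv (by ring)
  have hC : ∀ t, 0 ≤ t → |⟪mulL2 (z t 0) (z t 0), z t 0⟫|
      ≤ 2 * K ^ 2 * (K + 1) * (Real.exp (-k * t) ^ 2 * (Real.exp (-k * t) + ‖z t 1‖)) := by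
    intro t ht
    have e0 := Real.exp_pos (-k * t)
    have b0 := hz0 t ht
    set ε := Real.exp (-k * t)
    have n1 := norm_nonneg (z t 1)
    calc |⟪mulL2 (z t 0) (z t 0), z t 0⟫| ≤ ‖mulL2 (z t 0) (z t 0)‖ * ‖z t 0‖ :=
          abs_real_inner_le_norm _ _
      _ ≤ (2 * (‖z t 0‖ + ‖z t 1‖) * ‖z t 0‖) * ‖z t 0‖ := by
          gcongr; exact (h.tower t ht 0 (by omega)).norm_mulL2_le _
      _ ≤ (2 * (K * ε + ‖z t 1‖) * (K * ε)) * (K * ε) := by gcongr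
      _ ≤ (2 * ((K + 1) * (ε + ‖z t 1‖)) * (K * ε)) * (K * ε) := by
          gcongr; nlinarith
      _ = _ := by ring
  set P := 2 * K ^ 2 * (K + 1)
  have hP : 0 ≤ P := by positivity
  refine exists_decay_of_energy (a := α) (m := |lam| * P + k * |lam| * P) hk hα (by positivity)
    (fun t ht => (hd t ht).continuousWithinAt)
    (fun t ht => (hd t ht.le).hasDerivAt (Ici_mem_nhds ht))
    (fun t ht => ?_) (fun t ht => ?_)
  · have c := hC t ht
    have c' := mul_le_mul_of_nonneg_left c (abs_nonneg lam)
    rw [← abs_mul] at c'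
    have := le_abs_self (lam * ⟪mulL2 (z t 0) (z t 0), z t 0⟫)
    have hq : 0 ≤ Real.exp (-k * t) ^ 2 * (Real.exp (-k * t) + ‖z t 1‖) := by positivity
    have q1 : 0 ≤ |lam| * (P * (Real.exp (-k * t) ^ 2 * (Real.exp (-k * t) + ‖z t 1‖))) := by
      positivity
    have q2 : 0 ≤ k * (|lam| * (P * (Real.exp (-k * t) ^ 2 * (Real.exp (-k * t) + ‖z t 1‖)))) := by
      positivity
    nlinarith
  · have c := hC t ht.le
    have c' := mul_le_mul_of_nonneg_left c (abs_nonneg lam)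
    rw [← abs_mul] at c'
    have c2 := (le_abs_self (lam * ⟪mulL2 (z t 0) (z t 0), z t 0⟫)).trans c'
    have c3 := mul_le_mul_of_nonneg_left c2 hk.le
    have q1 : 0 ≤ |lam| * (P * (Real.exp (-k * t) ^ 2 * (Real.exp (-k * t) + ‖z t 1‖))) := by
      positivity
    have q2 := mul_nonneg hk.le q1
    have T := h.tower t ht.le
    rw [energy_identity_one (T 0 (by omega)) (T 1 (by omega)) (T 2 (by omega)) (h.eqn t ht.le)]
    nlinarith

end IsDampedKdV

/-! ### Decay at second order -/

theorem continuousOn_mulL2 {f f' g : ℝ → L2} {S : Set ℝ} (hf : ContinuousOn f S)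
    (hf' : ContinuousOn f' S) (hg : ContinuousOn g S)
    (h : ∀ t ∈ S, IsPeriodicWeakDeriv (f t) (f' t)) :
    ContinuousOn (fun t => mulL2 (f t) (g t)) S := fun t ht =>
  tendsto_mulL2 (hf t ht) (hf' t ht) (hg t ht)
    (by filter_upwards [self_mem_nhdsWithin] with s hs using h s hs) (h t ht)

theorem abs_inner_mulL2_deriv_sq_le {z₀ z₁ z₂ : L2} (h0 : IsPeriodicWeakDeriv z₀ z₁)
    (h1 : IsPeriodicWeakDeriv z₁ z₂) :
    |⟪mulL2 z₁ z₁, z₀⟫| ≤ 2 * (‖z₀‖ + ‖z₁‖) * ‖z₁‖ * ‖z₁‖ := by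
  rw [inner_mulL2_right_comm h1.memLp_top, mulL2_comm]
  exact (abs_real_inner_le_norm _ _).trans
    (mul_le_mul_of_nonneg_right (h0.norm_mulL2_le _) (norm_nonneg _))

theorem abs_inner_mulL2_mulL2_le {z₀ z₁ z₂ : L2} (h0 : IsPeriodicWeakDeriv z₀ z₁)
    (h1 : IsPeriodicWeakDeriv z₁ z₂) :
    |⟪mulL2 z₁ z₁, mulL2 z₀ z₁⟫|
      ≤ (2 * (‖z₁‖ + ‖z₂‖) * ‖z₁‖) * (2 * (‖z₀‖ + ‖z₁‖) * ‖z₁‖) :=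
  (abs_real_inner_le_norm _ _).trans
    (mul_le_mul (h1.norm_mulL2_le _) (h0.norm_mulL2_le _) (norm_nonneg _) (by positivity))

namespace IsDampedKdV

variable {α β lam k : ℝ} {r : ℕ} {z zt : ℝ → ℕ → L2}

/-- The nonlinear and damping terms have only one derivative, so that the energy identity for
`‖zₓₓ‖²` holds although `‖zₓₓ‖²` involves one derivative more than `z'` admits. -/
theorem hasDerivAt_norm_sq_two (h : IsDampedKdV α β lam k r z zt) (hα : 0 < α) {t : ℝ}
    (ht : 0 < t) : HasDerivAt (fun t => ‖z t 2‖ ^ 2)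
      (-2 * ⟪-(β • z t 2 + lam • (mulL2 (z t 1) (z t 1) + mulL2 (z t 0) (z t 2)) + k • z t 1),
        z t 3⟫) t := by
  have c : ∀ j ≤ 3, ContinuousOn (fun t => z t j) (Ici 0) := fun j hj => h.cont j (by omega)
  have T : ∀ j < 3, ∀ t, 0 ≤ t → IsPeriodicWeakDeriv (z t j) (z t (j + 1)) :=
    fun j hj t ht => h.tower t ht j (by omega)
  have c01 := continuousOn_mulL2 (c 0 (by omega)) (c 1 (by omega)) (c 1 (by omega))
    (T 0 (by omega))
  have c02 := continuousOn_mulL2 (c 0 (by omega)) (c 1 (by omega)) (c 2 (by omega))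
    (T 0 (by omega))
  have c11 := continuousOn_mulL2 (c 1 (by omega)) (c 2 (by omega)) (c 1 (by omega))
    (T 1 (by omega))
  have cg0 : ContinuousOn
      (fun t => -(β • z t 1 + lam • mulL2 (z t 0) (z t 1) + k • z t 0)) (Ici 0) :=
    ((((c 1 (by omega)).const_smul β).add (c01.const_smul lam)).add
      ((c 0 (by omega)).const_smul k)).neg
  have cg1 : ContinuousOn (fun t => -(β • z t 2
      + lam • (mulL2 (z t 1) (z t 1) + mulL2 (z t 0) (z t 2)) + k • z t 1)) (Ici 0) :=
    ((((c 2 (by omega)).const_smul β).add ((c11.add c02).const_smul lam)).add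
      ((c 1 (by omega)).const_smul k)).neg
  have hm : Continuous fun t : ℝ => max t 0 := by fun_prop
  have hmem : ∀ t : ℝ, max t 0 ∈ Ici (0 : ℝ) := fun t => mem_Ici.2 (le_max_right _ _)
  have ext : ∀ {f : ℝ → L2}, ContinuousOn f (Ici 0) → Continuous fun t => f (max t 0) :=
    fun hf => hf.comp_continuous hm hmem
  have ev : ∀ {t : ℝ}, 0 < t → ∀ᶠ s in 𝓝 t, max s 0 = s := fun ht => by
    filter_upwards [Ioi_mem_nhds ht] with s hs using max_eq_left (le_of_lt hs)
  have key := hasDerivAt_norm_sq_second hα.ne' (z₀ := fun t => z (max t 0) 0)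
    (z₁ := fun t => z (max t 0) 1)
    (ext (c 2 (by omega))) (ext (c 3 (by omega))) (ext cg0) (ext cg1)
    (fun t => T 0 (by omega) _ (hmem t)) (fun t => T 1 (by omega) _ (hmem t))
    (fun t => T 2 (by omega) _ (hmem t))
    (fun t => by
      have a0 := T 0 (by omega) _ (hmem t)
      have a1 := T 1 (by omega) _ (hmem t)
      have := (((a1.smul β).add ((a0.mul a1).smul lam)).add (a0.smul k)).smul (-1)
      simpa only [neg_one_smul] using this)
    (fun t ht => by
      have d := (h.hasDeriv 0 (by omega) t ht.le).hasDerivAt (Ici_mem_nhds ht)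
      rw [h.eqn t ht.le] at d
      have e : max t 0 = t := max_eq_left ht.le
      rw [e]
      refine (d.congr_of_eventuallyEq ?_).congr_deriv ?_
      · filter_upwards [ev ht] with s hs using by rw [hs]
      · abel) ht
  rw [max_eq_left ht.le] at key
  refine key.congr_of_eventuallyEq ?_
  filter_upwards [ev ht] with s hs using by rw [hs]

theorem decay_two (h : IsDampedKdV α β lam k r z zt) (hα : 0 < α) (hk : 0 < k) :
    ∃ K, 0 ≤ K ∧ ∀ t, 0 ≤ t → ‖z t 2‖ ≤ K * Real.exp (-k * t) := by
  obtain ⟨K₀, hK₀, hz0⟩ := h.decay_zero hk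
  obtain ⟨K₁, hK₁, hz1⟩ := h.decay_one hα hk
  have hdD : ∀ t, 0 ≤ t → HasDerivWithinAt
      (fun t => ⟪mulL2 (z t 1) (z t 1), z t 0⟫)
      (-⟪zt t 0, mulL2 (z t 1) (z t 1) + (mulL2 (z t 0) (z t 2) + mulL2 (z t 0) (z t 2))⟫)
      (Ici 0) t := fun t ht =>
    hasDerivWithinAt_mul_deriv_sq (z₀ := fun s => z s 0) (z₁ := fun s => z s 1)
      (z₂ := fun s => z s 2) ht (fun s hs => h.tower s hs 0 (by omega))
      (fun s hs => h.tower s hs 1 (by omega)) (h.cont 1 (by omega) t ht)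
      (h.cont 2 (by omega) t ht) (h.hasDeriv 0 (by omega) t ht)
  set P := 2 * (K₀ + K₁) * K₁ ^ 2 with hP
  have hP0 : 0 ≤ P := by positivity
  have hD : ∀ t, 0 ≤ t → |⟪mulL2 (z t 1) (z t 1), z t 0⟫|
      ≤ P * (Real.exp (-k * t) ^ 2 * (Real.exp (-k * t) + ‖z t 2‖)) := by
    intro t ht
    have e0 := Real.exp_pos (-k * t)
    have b0 := hz0 t ht
    have b1 := hz1 t ht
    set ε := Real.exp (-k * t)
    have n2 := norm_nonneg (z t 2)
    have T := h.tower t ht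
    calc |⟪mulL2 (z t 1) (z t 1), z t 0⟫| ≤ 2 * (‖z t 0‖ + ‖z t 1‖) * ‖z t 1‖ * ‖z t 1‖ :=
          abs_inner_mulL2_deriv_sq_le (T 0 (by omega)) (T 1 (by omega))
      _ ≤ (2 * (K₀ * ε + K₁ * ε) * (K₁ * ε)) * (K₁ * ε) := by gcongr
      _ = P * (ε ^ 2 * (ε + 0)) := by rw [hP]; ring
      _ ≤ _ := by gcongr
  set Q := 4 * (K₀ + K₁) * K₁ ^ 2 * (K₁ + 1) with hQ
  have hQ0 : 0 ≤ Q := by positivity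
  have hK : ∀ t, 0 ≤ t → |⟪mulL2 (z t 1) (z t 1), mulL2 (z t 0) (z t 1)⟫|
      ≤ Q * (Real.exp (-k * t) ^ 2 * (Real.exp (-k * t) + ‖z t 2‖)) := by
    intro t ht
    have e0 := Real.exp_pos (-k * t)
    have e1 := exp_neg_mul_le_one hk ht
    have b0 := hz0 t ht
    have b1 := hz1 t ht
    set ε := Real.exp (-k * t)
    have n2 := norm_nonneg (z t 2)
    calc |⟪mulL2 (z t 1) (z t 1), mulL2 (z t 0) (z t 1)⟫|
        ≤ (2 * (‖z t 1‖ + ‖z t 2‖) * ‖z t 1‖) * (2 * (‖z t 0‖ + ‖z t 1‖) * ‖z t 1‖) :=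
          abs_inner_mulL2_mulL2_le (h.tower t ht 0 (by omega)) (h.tower t ht 1 (by omega))
      _ ≤ (2 * (K₁ * ε + ‖z t 2‖) * (K₁ * ε)) * (2 * (K₀ * ε + K₁ * ε) * (K₁ * ε)) := by gcongr
      _ ≤ (2 * ((K₁ + 1) * (ε + ‖z t 2‖)) * (K₁ * ε)) * (2 * (K₀ * ε + K₁ * ε) * (K₁ * ε)) := by
          gcongr; nlinarith
      _ = Q * (ε ^ 2 * (ε + ‖z t 2‖)) * ε := by rw [hQ]; ring
      _ ≤ _ := mul_le_of_le_one_right (by positivity) e1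
  have hE : ContinuousOn (fun t => α * ‖z t 2‖ ^ 2
      - 5 / 3 * lam * ⟪mulL2 (z t 1) (z t 1), z t 0⟫) (Ici 0) :=
    (continuousOn_const.mul ((h.cont 2 (by omega)).norm.pow 2)).sub
      (continuousOn_const.mul fun t ht => (hdD t ht).continuousWithinAt)
  refine exists_decay_of_energy (a := α)
    (m := 5 / 3 * |lam| * P + (5 / 3 * k * |lam| * P + 5 / 3 * lam ^ 2 * Q)) hk hα
    (by positivity) hE
    (fun t ht => ((h.hasDerivAt_norm_sq_two hα ht).const_mul α).sub
      (((hdD t ht.le).hasDerivAt (Ici_mem_nhds ht)).const_mul (5 / 3 * lam)))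
    (fun t ht => ?_) (fun t ht => ?_)
  · have c := mul_le_mul_of_nonneg_left (hD t ht) (abs_nonneg lam)
    rw [← abs_mul] at c
    have c2 := (le_abs_self (lam * ⟪mulL2 (z t 1) (z t 1), z t 0⟫)).trans c
    have hq : 0 ≤ Real.exp (-k * t) ^ 2 * (Real.exp (-k * t) + ‖z t 2‖) := by positivity
    set q := Real.exp (-k * t) ^ 2 * (Real.exp (-k * t) + ‖z t 2‖)
    have q1 : 0 ≤ (5 / 3 * k * |lam| * P + 5 / 3 * lam ^ 2 * Q) * q := by positivity
    rw [mul_assoc (_ + _)]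
    linarith
  · have T := h.tower t ht.le
    rw [energy_identity_two (T 0 (by omega)) (T 1 (by omega)) (T 2 (by omega)) (h.eqn t ht.le)]
    have c := mul_le_mul_of_nonneg_left (hD t ht.le) (abs_nonneg lam)
    rw [← abs_mul] at c
    have c2 := (le_abs_self (lam * ⟪mulL2 (z t 1) (z t 1), z t 0⟫)).trans c
    have c3 := mul_le_mul_of_nonneg_left c2 hk.le
    have c4 := mul_le_mul_of_nonneg_left ((le_abs_self _).trans (hK t ht.le)) (sq_nonneg lam)
    have hq : 0 ≤ Real.exp (-k * t) ^ 2 * (Real.exp (-k * t) + ‖z t 2‖) := by positivity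
    set q := Real.exp (-k * t) ^ 2 * (Real.exp (-k * t) + ‖z t 2‖)
    have q1 : 0 ≤ 5 / 3 * |lam| * P * q := by positivity
    rw [mul_assoc (_ + _)]
    linarith

end IsDampedKdV

/-! ### Decay at higher orders -/

theorem sq_towerNorm_le (n : ℕ) (p : ℕ → L2) :
    towerNorm n p ^ 2 ≤ (n + 1) * ∑ i ∈ Finset.range (n + 1), ‖p i‖ ^ 2 := by
  have := sq_sum_le_card_mul_sum_sq (s := Finset.range (n + 1)) (f := fun i => ‖p i‖)
  simpa [towerNorm] using this

namespace IsDampedKdV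

variable {α β lam k : ℝ} {r : ℕ} {z zt : ℝ → ℕ → L2}

/-- The difference `y = z(t+δ) - z(t)` of two solutions solves a linear equation with coefficient
`p = (z(t+δ) + z(t)) / 2`. -/
theorem eqn_sub (h : IsDampedKdV α β lam k r z zt) {t δ : ℝ} (ht : 0 ≤ t) (hδ : 0 < δ) :
    zt (t + δ) 0 - zt t 0 = -(α • (z (t + δ) 3 - z t 3) + β • (z (t + δ) 1 - z t 1)
      + lam • (mulL2 ((1 / 2 : ℝ) • (z (t + δ) 0 + z t 0)) (z (t + δ) 1 - z t 1)
        + mulL2 ((1 / 2 : ℝ) • (z (t + δ) 1 + z t 1)) (z (t + δ) 0 - z t 0))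
      + k • (z (t + δ) 0 - z t 0)) := by
  have hs : 0 ≤ t + δ := by positivity
  have a0 := (h.tower _ hs 0 (by omega))
  have a1 := (h.tower _ hs 1 (by omega))
  have b0 := (h.tower _ ht 0 (by omega))
  have b1 := (h.tower _ ht 1 (by omega))
  have p0 := ((a0.add b0).smul (1 / 2)).memLp_top
  have p1 := ((a1.add b1).smul (1 / 2)).memLp_top
  have key : mulL2 (z (t + δ) 0) (z (t + δ) 1) - mulL2 (z t 0) (z t 1)
      = mulL2 ((1 / 2 : ℝ) • (z (t + δ) 0 + z t 0)) (z (t + δ) 1 - z t 1)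
        + mulL2 ((1 / 2 : ℝ) • (z (t + δ) 1 + z t 1)) (z (t + δ) 0 - z t 0) := by
    refine Lp.ext ?_
    filter_upwards [coeFn_mulL2 a0.memLp_top (z (t + δ) 1), coeFn_mulL2 b0.memLp_top (z t 1),
      coeFn_mulL2 p0 (z (t + δ) 1 - z t 1), coeFn_mulL2 p1 (z (t + δ) 0 - z t 0),
      Lp.coeFn_sub (z (t + δ) 0) (z t 0), Lp.coeFn_sub (z (t + δ) 1) (z t 1),
      Lp.coeFn_add (z (t + δ) 0) (z t 0), Lp.coeFn_add (z (t + δ) 1) (z t 1),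
      Lp.coeFn_smul (1 / 2 : ℝ) (z (t + δ) 0 + z t 0),
      Lp.coeFn_smul (1 / 2 : ℝ) (z (t + δ) 1 + z t 1),
      Lp.coeFn_sub (mulL2 (z (t + δ) 0) (z (t + δ) 1)) (mulL2 (z t 0) (z t 1)),
      Lp.coeFn_add (mulL2 ((1 / 2 : ℝ) • (z (t + δ) 0 + z t 0)) (z (t + δ) 1 - z t 1))
        (mulL2 ((1 / 2 : ℝ) • (z (t + δ) 1 + z t 1)) (z (t + δ) 0 - z t 0))]
      with x h1 h2 h3 h4 h5 h6 h7 h8 h9 h10 h11 h12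
    simp only [h11, h12, Pi.sub_apply, Pi.add_apply, Pi.smul_apply, h1, h2, h3, h4, h5, h6, h7, h8,
      h9, h10, smul_eq_mul]
    ring
  rw [h.eqn _ hs, h.eqn _ ht, ← key]
  simp only [smul_sub]
  abel

/-- Dissipation of the `Hⁿ` norm of a time increment, up to a term controlled by the `Hⁿ⁺²` norm
of the solution. -/
theorem exists_increment_estimate (h : IsDampedKdV α β lam k r z zt) {n : ℕ} (hn : n ≤ r) :
    ∃ C : ℝ, 0 ≤ C ∧ ∀ t δ, 0 ≤ t → 0 < δ →
      ∑ i ∈ Finset.range (n + 1), 2 * ⟪z (t + δ) i - z t i, zt (t + δ) i - zt t i⟫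
      + 2 * k * ∑ i ∈ Finset.range (n + 1), ‖z (t + δ) i - z t i‖ ^ 2
      ≤ C * (towerNorm (n + 2) (z (t + δ)) + towerNorm (n + 2) (z t))
        * ∑ i ∈ Finset.range (n + 1), ‖z (t + δ) i - z t i‖ ^ 2 := by
  obtain ⟨C, hC, htr⟩ := exists_tower_transport n
  refine ⟨(n + 1) * (2 * |lam| * C * (1 / 2) * (n + 1)), by positivity, fun t δ ht hδ => ?_⟩
  have hs : 0 ≤ t + δ := by positivity
  have Ta := h.tower _ hs
  have Tb := h.tower _ ht
  set y : ℕ → L2 := fun i => z (t + δ) i - z t i with hy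
  set p : ℕ → L2 := fun i => (1 / 2 : ℝ) • (z (t + δ) i + z t i) with hp
  have Ty : IsTower (r + 3) y := fun i hi => (Ta i hi).sub (Tb i hi)
  have Tp : IsTower (r + 3) p := (Ta.add Tb).smul _
  have Tyt : IsTower r fun i => zt (t + δ) i - zt t i := fun i hi =>
    (h.tower_deriv _ hs i hi).sub (h.tower_deriv _ ht i hi)
  obtain ⟨P, TP, hP0, hPb⟩ := htr p y (Tp.mono (by omega)) (Ty.mono (by omega))
  have Trhs : IsTower n fun i =>
      (-1 : ℝ) • (α • y (i + 3) + β • y (i + 1) + lam • P i + k • y i) := by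
    refine IsTower.smul _ ((IsTower.add (IsTower.add ?_ ?_) (TP.smul _)).add
      ((Ty.mono (by omega)).smul _))
    · exact IsTower.smul _ fun i hi => Ty (i + 3) (by omega)
    · exact IsTower.smul _ fun i hi => Ty (i + 1) (by omega)
  have heq := (Tyt.mono hn).unique Trhs (by
    rw [h.eqn_sub ht hδ, hP0, neg_one_smul])
  have hnorm : towerNorm (n + 2) p
      ≤ 1 / 2 * (towerNorm (n + 2) (z (t + δ)) + towerNorm (n + 2) (z t)) := by
    rw [hp, towerNorm_smul]
    rw [abs_of_pos (by norm_num : (0 : ℝ) < 1 / 2)]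
    exact mul_le_mul_of_nonneg_left (towerNorm_add_le _ _ _) (by norm_num)
  set A := towerNorm (n + 2) (z (t + δ)) + towerNorm (n + 2) (z t)
  set N := ∑ i ∈ Finset.range (n + 1), ‖y i‖ ^ 2 with hN
  have hA : 0 ≤ A := add_nonneg (towerNorm_nonneg _ _) (towerNorm_nonneg _ _)
  have hN0 : 0 ≤ N := Finset.sum_nonneg fun _ _ => sq_nonneg _
  have hyN : towerNorm n y ^ 2 ≤ (n + 1) * N := sq_towerNorm_le n y
  have term : ∀ i ∈ Finset.range (n + 1), 2 * ⟪y i, zt (t + δ) i - zt t i⟫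
      ≤ -(2 * k * ‖y i‖ ^ 2) + 2 * |lam| * C * (1 / 2) * (n + 1) * (A * N) := by
    intro i hi
    have hi' : i ≤ n := by rw [Finset.mem_range] at hi; omega
    have e1 : ⟪y i, y (i + 3)⟫ = 0 := by
      rw [(Ty i (by omega)).inner_eq_neg (Ty (i + 2) (by omega)),
        (Ty (i + 1) (by omega)).inner_self_eq_zero, neg_zero]
    have e2 : ⟪y i, y (i + 1)⟫ = 0 := (Ty i (by omega)).inner_self_eq_zero
    have hb : |⟪P i, y i⟫| ≤ C * (1 / 2 * A) * ((n + 1) * N) :=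
      (hPb i hi').trans (mul_le_mul (mul_le_mul_of_nonneg_left hnorm hC) hyN (sq_nonneg _)
        (by positivity))
    have hb2 : -(lam * ⟪P i, y i⟫) ≤ |lam| * (C * (1 / 2 * A) * ((n + 1) * N)) :=
      (neg_le_abs _).trans (by rw [abs_mul]; exact mul_le_mul_of_nonneg_left hb (abs_nonneg _))
    have e3 : zt (t + δ) i - zt t i
        = (-1 : ℝ) • (α • y (i + 3) + β • y (i + 1) + lam • P i + k • y i) := heq i hi'
    rw [e3]
    simp only [inner_add_right, inner_smul_right, e1, e2, real_inner_self_eq_norm_sq,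
      real_inner_comm (P i) (y i)]
    nlinarith
  have hsum := Finset.sum_le_sum term
  rw [Finset.sum_add_distrib, Finset.sum_neg_distrib, ← Finset.mul_sum _ _ (2 * k),
    Finset.sum_const, Finset.card_range, nsmul_eq_mul, ← hN] at hsum
  push_cast at hsum
  nlinarith

/-- Decay of the time derivative in `Hⁿ`, given the decay of the solution in `Hⁿ⁺²`. -/
theorem decay_deriv (h : IsDampedKdV α β lam k r z zt) (hk : 0 < k) {n : ℕ} (hn : n ≤ r)
    {K : ℝ} (hK : 0 ≤ K) (hz : ∀ t, 0 ≤ t → towerNorm (n + 2) (z t) ≤ K * Real.exp (-k * t)) :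
    ∃ K', 0 ≤ K' ∧ ∀ t, 0 ≤ t → ‖zt t n‖ ≤ K' * Real.exp (-k * t) := by
  obtain ⟨C, hC, hest⟩ := h.exists_increment_estimate hn
  set L := Real.exp (C * (2 * K) / k)
  set N := fun t δ => ∑ i ∈ Finset.range (n + 1), ‖z (t + δ) i - z t i‖ ^ 2 with hN
  -- The Gronwall bound for increments is uniform in the size `δ` of the time step.
  have hinc : ∀ δ, 0 < δ → ∀ t, 0 ≤ t → N t δ ≤ N 0 δ * L * Real.exp (-k * t) ^ 2 := by
    intro δ hδ
    have hN0 : 0 ≤ N 0 δ := Finset.sum_nonneg fun _ _ => sq_nonneg _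
    have hd : ∀ i ≤ r, ∀ t, 0 ≤ t → HasDerivWithinAt (fun t => z (t + δ) i - z t i)
        (zt (t + δ) i - zt t i) (Ici 0) t := by
      intro i hi t ht
      have hs : 0 < t + δ := by positivity
      have d := ((h.hasDeriv i hi (t + δ) hs.le).hasDerivAt (Ici_mem_nhds hs)).comp_add_const t δ
      exact d.hasDerivWithinAt.sub (h.hasDeriv i hi t ht)
    have hdN : ∀ t, 0 ≤ t → HasDerivWithinAt (fun t => N t δ)
        (∑ i ∈ Finset.range (n + 1), 2 * ⟪z (t + δ) i - z t i, zt (t + δ) i - zt t i⟫)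
        (Ici 0) t := by
      intro t ht
      refine HasDerivWithinAt.fun_sum fun i hi => ?_
      have hi' : i ≤ r := by rw [Finset.mem_range] at hi; omega
      exact (hd i hi' t ht).norm_sq
    have := gronwall_exp_decay (c := 0) (M := C * (2 * K)) hk (by positivity) le_rfl
      (fun t ht => (hdN t ht).continuousWithinAt)
      (fun t ht => (hdN t ht.le).hasDerivAt (Ici_mem_nhds ht)) fun t ht => by
        have hs : 0 ≤ t + δ := by positivity
        have hNt : 0 ≤ N t δ := Finset.sum_nonneg fun _ _ => sq_nonneg _
        refine (hest t δ ht.le hδ).trans ?_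
        rw [zero_mul, add_zero]
        refine mul_le_mul_of_nonneg_right ?_ hNt
        rw [mul_assoc C]
        refine mul_le_mul_of_nonneg_left ?_ hC
        have a := hz t ht.le
        have b := hz (t + δ) hs
        have c : Real.exp (-k * (t + δ)) ≤ Real.exp (-k * t) :=
          Real.exp_le_exp.2 (by nlinarith)
        nlinarith [mul_le_mul_of_nonneg_left c hK]
    intro t ht
    simpa [abs_of_nonneg hN0] using this t ht
  have hlim : ∀ i ≤ r, ∀ t, 0 ≤ t →
      Tendsto (fun δ => ‖δ⁻¹ • (z (t + δ) i - z t i)‖ ^ 2) (𝓝[>] 0) (𝓝 (‖zt t i‖ ^ 2)) := by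
    intro i hi t ht
    have d : HasDerivWithinAt (fun τ => z τ i) (zt t i) (Ioi t) t :=
      (h.hasDeriv i hi t ht).mono (fun s hs => ht.trans (le_of_lt hs))
    have d' := (hasDerivWithinAt_iff_tendsto_slope' (by simp)).1 d
    have m : Tendsto (fun δ : ℝ => t + δ) (𝓝[>] 0) (𝓝[>] t) := by
      refine tendsto_nhdsWithin_iff.2 ⟨?_, ?_⟩
      · have : Tendsto (fun δ : ℝ => t + δ) (𝓝 0) (𝓝 (t + 0)) := by
          exact (continuous_const.add continuous_id).tendsto 0
        rw [add_zero] at this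
        exact this.mono_left nhdsWithin_le_nhds
      · filter_upwards [self_mem_nhdsWithin] with δ hδ
        exact lt_add_of_pos_right t hδ
    refine (((d'.comp m).norm.pow 2)).congr fun δ => ?_
    simp [slope_def_module]
  set S := ∑ i ∈ Finset.range (n + 1), ‖zt 0 i‖ ^ 2
  have hS : 0 ≤ S := Finset.sum_nonneg fun _ _ => sq_nonneg _
  refine ⟨Real.sqrt (S * L), Real.sqrt_nonneg _, fun t ht => ?_⟩
  have h0 : Tendsto (fun δ => (∑ i ∈ Finset.range (n + 1), ‖δ⁻¹ • (z (0 + δ) i - z 0 i)‖ ^ 2)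
      * L * Real.exp (-k * t) ^ 2) (𝓝[>] 0) (𝓝 (S * L * Real.exp (-k * t) ^ 2)) :=
    ((tendsto_finsetSum _ fun i hi => hlim i (by rw [Finset.mem_range] at hi; omega) 0
      le_rfl).mul_const _).mul_const _
  have hle : ‖zt t n‖ ^ 2 ≤ S * L * Real.exp (-k * t) ^ 2 := by
    refine le_of_tendsto_of_tendsto (hlim n hn t ht) h0 ?_
    filter_upwards [self_mem_nhdsWithin] with δ hδ
    have hi := hinc δ hδ t ht
    have h1 : ‖z (t + δ) n - z t n‖ ^ 2 ≤ N t δ :=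
      Finset.single_le_sum (f := fun i => ‖z (t + δ) i - z t i‖ ^ 2) (fun _ _ => sq_nonneg _)
        (Finset.mem_range.2 (Nat.lt_succ_self n))
    simp only [norm_smul, mul_pow]
    rw [← Finset.mul_sum]
    have := mul_le_mul_of_nonneg_left (h1.trans hi) (sq_nonneg ‖δ⁻¹‖)
    refine this.trans (le_of_eq ?_)
    rw [hN]
    ring
  have e0 := Real.exp_pos (-k * t)
  refine abs_le_of_sq_le_sq' ?_ (by positivity) |>.2
  rw [mul_pow, Real.sq_sqrt (by positivity)]
  exact hle

/-- Exponential decay of all spatial derivatives. -/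
theorem decay (h : IsDampedKdV α β lam k r z zt) (hα : 0 < α) (hk : 0 < k) :
    ∀ j ≤ r + 3, ∃ K, 0 ≤ K ∧ ∀ t, 0 ≤ t → ‖z t j‖ ≤ K * Real.exp (-k * t) := by
  intro j
  induction j using Nat.strong_induction_on with
  | _ j ih =>
    intro hj
    match j with
    | 0 => exact h.decay_zero hk
    | 1 => exact h.decay_one hα hk
    | 2 => exact h.decay_two hα hk
    | n + 3 =>
      have hn : n ≤ r := by omega
      have hsum : ∃ K, 0 ≤ K ∧ ∀ t, 0 ≤ t →
          towerNorm (n + 2) (z t) ≤ K * Real.exp (-k * t) := by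
        choose! K hK hb using ih
        refine ⟨∑ i ∈ Finset.range (n + 2 + 1), K i, Finset.sum_nonneg fun i hi => ?_,
          fun t ht => ?_⟩
        · rw [Finset.mem_range] at hi
          exact hK i (by omega) (by omega)
        · rw [towerNorm, Finset.sum_mul]
          refine Finset.sum_le_sum fun i hi => ?_
          rw [Finset.mem_range] at hi
          exact hb i (by omega) (by omega) t ht
      obtain ⟨K, hK, hz⟩ := hsum
      obtain ⟨K', hK', hzt⟩ := h.decay_deriv hk hn hK hz
      obtain ⟨C, hC, hprod⟩ := exists_tower_mulL2 n
      refine ⟨α⁻¹ * (K' + |β| * K + |lam| * (C * K * K) + k * K), by positivity, fun t ht => ?_⟩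
      have T := h.tower t ht
      obtain ⟨P, TP, hP0, hPb⟩ := hprod (fun i => z t (i + 1)) (z t)
        (fun i hi => T (i + 1) (by omega)) (T.mono (by omega))
      have Trhs : IsTower n fun i =>
          (-1 : ℝ) • (α • z t (i + 3) + β • z t (i + 1) + lam • P i + k • z t i) := by
        refine IsTower.smul _ ((IsTower.add (IsTower.add ?_ ?_) (TP.smul _)).add
          ((T.mono (by omega)).smul _))
        · exact IsTower.smul _ fun i hi => T (i + 3) (by omega)
        · exact IsTower.smul _ fun i hi => T (i + 1) (by omega)
      have heq : zt t n = (-1 : ℝ) • (α • z t (n + 3) + β • z t (n + 1) + lam • P n + k • z t n) :=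
        ((h.tower_deriv t ht).mono hn).unique Trhs
          (by rw [h.eqn t ht, hP0, mulL2_comm, neg_one_smul]) n le_rfl
      have hsolve : α • z t (n + 3) = -(zt t n + β • z t (n + 1) + lam • P n + k • z t n) := by
        rw [heq, neg_one_smul]; abel
      have e0 := Real.exp_pos (-k * t)
      have e1 := exp_neg_mul_le_one hk ht
      have hzn := hz t ht
      have b1 := hzt t ht
      have b2 := (norm_le_towerNorm (show n + 1 ≤ n + 2 by omega) (z t)).trans hzn
      have b3 := (norm_le_towerNorm (show n ≤ n + 2 by omega) (z t)).trans hzn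
      set ε := Real.exp (-k * t)
      have b4 : ‖P n‖ ≤ C * K * K * ε := by
        have a1 : towerNorm n (fun i => z t (i + 1)) ≤ K * ε :=
          (towerNorm_shift_le n (z t)).trans ((towerNorm_mono (by omega) _).trans hzn)
        have a2 : towerNorm (n + 1) (z t) ≤ K := by
          refine (towerNorm_mono (by omega) _).trans (hzn.trans ?_)
          exact mul_le_of_le_one_right hK e1
        calc ‖P n‖ ≤ C * towerNorm n (fun i => z t (i + 1)) * towerNorm (n + 1) (z t) :=
              hPb n le_rfl
          _ ≤ C * (K * ε) * K := mul_le_mul (mul_le_mul_of_nonneg_left a1 hC) a2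
              (towerNorm_nonneg _ _) (by positivity)
          _ = _ := by ring
      have hb : α * ‖z t (n + 3)‖ ≤ ‖zt t n‖ + |β| * ‖z t (n + 1)‖ + |lam| * ‖P n‖
          + k * ‖z t n‖ := by
        calc α * ‖z t (n + 3)‖ = ‖α • z t (n + 3)‖ := by
              rw [norm_smul, Real.norm_of_nonneg hα.le]
          _ ≤ ‖zt t n‖ + ‖β • z t (n + 1)‖ + ‖lam • P n‖ + ‖k • z t n‖ := by
              rw [hsolve, norm_neg]
              exact (norm_add_le _ _).trans (add_le_add_left (norm_add₃_le) _)
          _ = _ := by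
              simp only [norm_smul, Real.norm_eq_abs, abs_of_pos hk]
      have c2 := mul_le_mul_of_nonneg_left b2 (abs_nonneg β)
      have c3 := mul_le_mul_of_nonneg_left b3 hk.le
      have c4 := mul_le_mul_of_nonneg_left b4 (abs_nonneg lam)
      rw [mul_assoc, inv_mul_eq_div, le_div_iff₀ hα]
      linarith

end IsDampedKdV

/-! ### Decoupling of the nonlinearity and the dispersion -/

/-- The relations that make `p u + q v` solve the scalar equation with dispersion `α` and
nonlinearity `lam`. -/
structure IsDecoupling (a₁ a₂ a₃ α lam p q : ℝ) : Prop where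
  pos : 0 < α
  quad_uu : p + q * a₂ = lam * p ^ 2
  quad_uv : p * a₂ + q * a₁ = lam * p * q
  quad_vv : p * a₁ + q = lam * q ^ 2
  disp_u : p + q * a₃ = α * p
  disp_v : p * a₃ + q = α * q

/-- A common root `τ` of the two quadratics makes `(1, τ)` a common eigenvector of the matrices
`(1, a₂; a₂, a₁)` and `(a₂, a₁; a₁, 1)` of the quadratic nonlinearity. -/
theorem isDecoupling_of_root {a₁ a₂ τ : ℝ}
    (h : a₂ * τ ^ 2 + (1 - a₁) * τ - a₂ = 0) (h' : a₁ * τ ^ 2 + (a₂ - 1) * τ - a₁ = 0) :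
    IsDecoupling a₁ a₂ 0 1 (1 + τ * a₂) 1 τ where
  pos := one_pos
  quad_uu := by ring
  quad_uv := by linear_combination -h
  quad_vv := by linear_combination -τ * h - h'
  disp_u := by ring
  disp_v := by ring

/-- Two independent decoupled components exist. For `a₃ = 0` the quadratics of
`isDecoupling_of_root` are proportional by `ha`, and they have two distinct real roots unless `a₁ = a₂ = 0`. -/
theorem exists_isDecoupling {a₁ a₂ a₃ : ℝ} (ha : a₁ ^ 2 + a₂ ^ 2 = a₁ + a₂) (ha₃ : |a₃| < 1)
    (h₁ : (a₁ - 1) * a₃ = 0) (h₂ : (a₂ - 1) * a₃ = 0) :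
    ∃ α lam p q α' lam' p' q', IsDecoupling a₁ a₂ a₃ α lam p q ∧
      IsDecoupling a₁ a₂ a₃ α' lam' p' q' ∧ p * q' - q * p' ≠ 0 := by
  obtain ⟨hl, hu⟩ := abs_lt.1 ha₃
  rcases eq_or_ne a₃ 0 with rfl | h3
  · rcases eq_or_ne a₁ 0 with rfl | h1
    · have : a₂ * (a₂ - 1) = 0 := by linear_combination ha
      rcases mul_eq_zero.1 this with rfl | h
      · exact ⟨1, 1, 1, 0, 1, 1, 0, 1, by constructor <;> norm_num, by constructor <;> norm_num,
          by norm_num⟩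
      · obtain rfl : a₂ = 1 := by linarith
        have s5 : Real.sqrt 5 ^ 2 = 5 := Real.sq_sqrt (by norm_num)
        have s0 : 0 < Real.sqrt 5 := by positivity
        refine ⟨_, _, _, _, _, _, _, _,
          isDecoupling_of_root (τ := (-1 + Real.sqrt 5) / 2) ?_ ?_,
          isDecoupling_of_root (τ := (-1 - Real.sqrt 5) / 2) ?_ ?_, ?_⟩
        · linear_combination s5 / 4
        · ring
        · linear_combination s5 / 4
        · ring
        · intro h; linarith
    · set d := Real.sqrt ((a₂ - 1) ^ 2 + 4 * a₁ ^ 2)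
      have dpos : 0 < d := Real.sqrt_pos.2 (by positivity)
      have d2 : d ^ 2 = (a₂ - 1) ^ 2 + 4 * a₁ ^ 2 := Real.sq_sqrt (by positivity)
      have root : ∀ τ, a₁ * τ ^ 2 + (a₂ - 1) * τ - a₁ = 0 →
          a₂ * τ ^ 2 + (1 - a₁) * τ - a₂ = 0 := by
        intro τ hτ
        refine (mul_eq_zero.1 (?_ : a₁ * _ = 0)).resolve_left h1
        linear_combination a₂ * hτ - τ * ha
      have r1 : a₁ * ((1 - a₂ + d) / (2 * a₁)) ^ 2 + (a₂ - 1) * ((1 - a₂ + d) / (2 * a₁)) - a₁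
          = 0 := by
        field_simp
        linear_combination d2
      have r2 : a₁ * ((1 - a₂ - d) / (2 * a₁)) ^ 2 + (a₂ - 1) * ((1 - a₂ - d) / (2 * a₁)) - a₁
          = 0 := by
        field_simp
        linear_combination d2
      refine ⟨_, _, _, _, _, _, _, _, isDecoupling_of_root (root _ r1) r1,
        isDecoupling_of_root (root _ r2) r2, ?_⟩
      have e : (1 : ℝ) * ((1 - a₂ - d) / (2 * a₁)) - (1 - a₂ + d) / (2 * a₁) * 1 = -d / a₁ := by
        field_simp
        ring
      rw [e]
      exact div_ne_zero (neg_ne_zero.2 dpos.ne') h1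
  · have e1 : a₁ = 1 := by linarith [(mul_eq_zero.1 h₁).resolve_right h3]
    have e2 : a₂ = 1 := by linarith [(mul_eq_zero.1 h₂).resolve_right h3]
    subst e1 e2
    refine ⟨1 + a₃, 2, 1, 1, 1 - a₃, 0, 1, -1, ?_, ?_, by norm_num⟩
    · constructor <;> linarith
    · constructor <;> linarith

/-! ### Reduction of the system to scalar equations -/

theorem coeFn_smul_add_smul (p q : ℝ) (f g : L2) :
    (p • f + q • g : L2) =ᵐ[mu01] fun x => p * f x + q * g x := by
  filter_upwards [Lp.coeFn_add (p • f) (q • g), Lp.coeFn_smul p f, Lp.coeFn_smul q g]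
    with x h1 h2 h3
  rw [h1, Pi.add_apply, h2, h3, Pi.smul_apply, Pi.smul_apply, smul_eq_mul, smul_eq_mul]

namespace Hper

variable {s : ℕ}

/-- The derivative `∂ₓʲ` as a continuous linear map `H^s → L²`. -/
def dxL (s j : ℕ) (hj : j ≤ s) : Hper s →L[ℝ] L2 :=
  (PiLp.proj 2 (fun _ : Fin (s + 1) => L2) (⟨j, by omega⟩ : Fin (s + 1)) :
    PiLp 2 (fun _ : Fin (s + 1) => L2) →L[ℝ] L2).comp (HperSubmodule s).subtypeL

/-- The sequence of derivatives of `w`, continued by zero beyond the order `s`. -/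
def jet (w : Hper s) (j : ℕ) : L2 := if h : j ≤ s then w.dx j h else 0

theorem jet_eq {j : ℕ} (hj : j ≤ s) (w : Hper s) : w.jet j = w.dx j hj := dif_pos hj

theorem isTower_jet (w : Hper s) : IsTower s w.jet := by
  intro i hi
  rw [jet_eq (by omega), jet_eq (by omega)]
  exact w.2 i hi

theorem norm_le_sum_jet (w : Hper s) : ‖w‖ ≤ towerNorm s w.jet := by
  refine abs_le_of_sq_le_sq' ?_ (towerNorm_nonneg _ _) |>.2
  have e : ‖w‖ ^ 2 = ∑ i ∈ Finset.range (s + 1), ‖w.jet i‖ ^ 2 := by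
    rw [show ‖w‖ = ‖w.1‖ from rfl, PiLp.norm_sq_eq_of_L2, Finset.sum_range]
    refine Finset.sum_congr rfl fun i _ => ?_
    rw [jet_eq (by omega)]
    rfl
  rw [e]
  exact Finset.sum_sq_le_sq_sum_of_nonneg fun _ _ => norm_nonneg _

theorem mean_add_smul (p q : ℝ) (u v : Hper s) :
    (p • u + q • v).mean = p * u.mean + q * v.mean := by
  have e : (p • u + q • v).toL2 = p • u.toL2 + q • v.toL2 := rfl
  rw [mean, mean, mean, e, ← integral_const_mul, ← integral_const_mul,
    ← integral_add (u.toL2.integrable.const_mul p) (v.toL2.integrable.const_mul q)]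
  apply integral_congr_ae
  exact coeFn_smul_add_smul p q u.toL2 v.toL2

theorem const_add_smul (p q a b : ℝ) :
    const s (p * a + q * b) = p • const s a + q • const s b := by
  refine Subtype.ext (PiLp.ext fun i => ?_)
  by_cases hi : i.1 = 0
  · have e : ∀ c : ℝ, (const s c).1 i = Lp.const 2 mu01 c := fun c => if_pos hi
    have e' : (p • const s a + q • const s b).1 i = p • (const s a).1 i + q • (const s b).1 i := rfl
    have h : Lp.const 2 mu01 (p * a + q * b)
        = p • Lp.const 2 mu01 a + q • Lp.const 2 mu01 b := by
      rw [map_add]; rfl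
    rw [e', e, e, e, h]
  · have e : ∀ c : ℝ, (const s c).1 i = 0 := fun c => if_neg hi
    have e' : (p • const s a + q • const s b).1 i = p • (const s a).1 i + q • (const s b).1 i := rfl
    rw [e', e, e, e, smul_zero, smul_zero, add_zero]

theorem sub_const_mean_add_smul (p q : ℝ) (u v : Hper s) :
    p • u + q • v - const s (p • u + q • v).mean
      = p • (u - const s u.mean) + q • (v - const s v.mean) := by
  rw [mean_add_smul, const_add_smul]
  module

theorem dx_zero_sub_const (w : Hper s) (c : ℝ) :
    (w - const s c).dx 0 (Nat.zero_le s) = w.dx 0 (Nat.zero_le s) - Lp.const 2 mu01 c := by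
  have : (const s c).dx 0 (Nat.zero_le s) = Lp.const 2 mu01 c := by simp [const, dx]
  rw [← this]; rfl

theorem dx_succ_sub_const (w : Hper s) (c : ℝ) {j : ℕ} (hj : j + 1 ≤ s) :
    (w - const s c).dx (j + 1) hj = w.dx (j + 1) hj := by
  have : (const s c).dx (j + 1) hj = 0 := by simp [const, dx]
  rw [← sub_zero (w.dx (j + 1) hj), ← this]; rfl

end Hper

theorem integral_mulL2_deriv {f g : L2} (h : IsPeriodicWeakDeriv f g) :
    ∫ x, mulL2 f g x ∂mu01 = 0 := by
  have h1 := (h.mul h).integral_eq_zero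
  rw [mulL2_comm g f] at h1
  have e : ∫ x, (mulL2 f g + mulL2 f g) x ∂mu01
      = ∫ x, mulL2 f g x ∂mu01 + ∫ x, mulL2 f g x ∂mu01 := by
    rw [← integral_add (mulL2 f g).integrable (mulL2 f g).integrable]
    apply integral_congr_ae
    filter_upwards [Lp.coeFn_add (mulL2 f g) (mulL2 f g)] with x hx using by rw [hx]; rfl
  rw [e] at h1
  linarith

section Decoupling

variable {a₁ a₂ a₃ k α lam p q : ℝ} {r : ℕ} {φ ψ : Hper (r + 3)} {u v : ℝ → Hper (r + 3)}

/-- The component `w = p u + q v` of a solution of the system solves a scalar equation as soon as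
`(p, q)` diagonalizes the dispersion matrix and the quadratic nonlinearity. -/
theorem IsSolution.eqn_component {hs : 3 ≤ r + 3}
    (huv : IsSolution a₁ a₂ a₃ 1 1 0 k hs φ ψ u v)
    (hd : IsDecoupling a₁ a₂ a₃ α lam p q)
    {t : ℝ} (ht : 0 ≤ t) :
    (p • derivWithin (fun τ => (u τ).incl r (Nat.le_add_right r 3)) (Ici 0) t
      + q • derivWithin (fun τ => (v τ).incl r (Nat.le_add_right r 3)) (Ici 0) t).jet 0
      = -(α • (p • u t + q • v t).jet 3
        + lam • mulL2 ((p • u t + q • v t).jet 0) ((p • u t + q • v t).jet 1)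
        + k • ((p • u t + q • v t).jet 0
          - Lp.const 2 mu01 (p • u t + q • v t).mean)) := by
  have eu := huv.eq_u t ht
  have ev := huv.eq_v t ht
  set du := derivWithin (fun τ => (u τ).incl r (Nat.le_add_right r 3)) (Ici 0) t with hdu
  set dv := derivWithin (fun τ => (v τ).incl r (Nat.le_add_right r 3)) (Ici 0) t with hdv
  have hdu' : derivWithin (fun τ => (u τ).incl (r + 3 - 3) (Nat.sub_le (r + 3) 3)) (Ici 0) t = du :=
    rfl
  have hdv' : derivWithin (fun τ => (v τ).incl (r + 3 - 3) (Nat.sub_le (r + 3) 3)) (Ici 0) t = dv :=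
    rfl
  rw [hdu'] at eu
  rw [hdv'] at ev
  have ed : (p • du + q • dv).jet 0 = p • du.toL2 + q • dv.toL2 := by
    rw [Hper.jet_eq (Nat.zero_le r)]; rfl
  have hw : IsPeriodicWeakDeriv ((p • u t + q • v t).jet 0) ((p • u t + q • v t).jet 1) :=
    (p • u t + q • v t).isTower_jet 0 (by omega)
  have ht0 := hw.memLp_top
  have ew : ∀ j (hj : j ≤ r + 3),
      (p • u t + q • v t).jet j = p • (u t).dx j hj + q • (v t).dx j hj :=
    fun j hj => by rw [Hper.jet_eq hj]; rfl
  rw [Hper.mean_add_smul, ed]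
  have m0 := coeFn_mulL2 ht0 ((p • u t + q • v t).jet 1)
  rw [ew 0 (by omega), ew 1 (by omega)] at m0
  rw [ew 0 (by omega), ew 1 (by omega), ew 3 (by omega)]
  have eval := coeFn_smul_add_smul p q
  set u0 := (u t).dx 0 (by omega)
  set u1 := (u t).dx 1 (by omega)
  set u3 := (u t).dx 3 (by omega)
  set v0 := (v t).dx 0 (by omega)
  set v1 := (v t).dx 1 (by omega)
  set v3 := (v t).dx 3 (by omega)
  set c := p * (u t).mean + q * (v t).mean with hc
  set M := mulL2 (p • u0 + q • v0) (p • u1 + q • v1)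
  refine Lp.ext ?_
  filter_upwards [eu, ev, eval du.toL2 dv.toL2, eval u0 v0, eval u1 v1, eval u3 v3, m0,
    Lp.coeFn_neg (α • (p • u3 + q • v3) + lam • M + k • (p • u0 + q • v0 - Lp.const 2 mu01 c)),
    Lp.coeFn_add (α • (p • u3 + q • v3) + lam • M) (k • (p • u0 + q • v0 - Lp.const 2 mu01 c)),
    Lp.coeFn_add (α • (p • u3 + q • v3)) (lam • M), Lp.coeFn_smul α (p • u3 + q • v3),
    Lp.coeFn_smul lam M, Lp.coeFn_smul k (p • u0 + q • v0 - Lp.const 2 mu01 c),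
    Lp.coeFn_sub (p • u0 + q • v0) (Lp.const 2 mu01 c), Lp.coeFn_const (p := 2) (μ := mu01) c]
    with x xu xv d0 x0 x1 x3 xm y1 y2 y3 y4 y5 y6 y7 y8
  rw [d0, y1, Pi.neg_apply, y2, Pi.add_apply, y3, Pi.add_apply, y4, y5, y6, Pi.smul_apply,
    Pi.smul_apply, Pi.smul_apply, y7, Pi.sub_apply, y8, xm, x0, x1, x3, Function.const_apply]
  simp only [smul_eq_mul]
  have hu0 : (u t).toL2 = u0 := rfl
  have hv0 : (v t).toL2 = v0 := rfl
  rw [hu0, hv0] at xu xv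
  have xu' : du.toL2 x = -(u0 x * u1 x + u3 x + a₃ * v3 x + a₁ * (v0 x * v1 x)
      + a₂ * (u1 x * v0 x + u0 x * v1 x) + k * (u0 x - (u t).mean)) := by
    linarith
  have xv' : dv.toL2 x = -(v0 x * v1 x + v3 x + a₃ * u3 x + a₂ * (u0 x * u1 x)
      + a₁ * (u1 x * v0 x + u0 x * v1 x) + k * (v0 x - (v t).mean)) := by
    linarith
  rw [xu', xv', hc]
  linear_combination (-(u0 x * u1 x)) * hd.quad_uu - (u1 x * v0 x + u0 x * v1 x) * hd.quad_uv
    - (v0 x * v1 x) * hd.quad_vv - u3 x * hd.disp_u - v3 x * hd.disp_v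

/-- Exponential decay of a scalar component of a solution of the system. -/
theorem IsSolution.decay_component {hs : 3 ≤ r + 3}
    (huv : IsSolution a₁ a₂ a₃ 1 1 0 k hs φ ψ u v) (hk : 0 < k)
    (hd : IsDecoupling a₁ a₂ a₃ α lam p q) :
    ∃ K, ∀ t, 0 ≤ t → ‖p • u t + q • v t
      - Hper.const (r + 3) (p • u t + q • v t).mean‖ ≤ K * Real.exp (-k * t) := by
  set w : ℝ → Hper (r + 3) := fun t => p • u t + q • v t with hw
  set dw : ℝ → Hper r := fun t =>
    p • derivWithin (fun τ => (u τ).incl r (Nat.le_add_right r 3)) (Ici 0) t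
      + q • derivWithin (fun τ => (v τ).incl r (Nat.le_add_right r 3)) (Ici 0) t with hdw
  have heq : ∀ t, 0 ≤ t → (dw t).jet 0 = -(α • (w t).jet 3
      + lam • mulL2 ((w t).jet 0) ((w t).jet 1)
      + k • ((w t).jet 0 - Lp.const 2 mu01 (w t).mean)) := fun t ht =>
    huv.eqn_component hd ht
  have hwc : ContinuousOn w (Ici 0) := (huv.cont_u.const_smul p).add (huv.cont_v.const_smul q)
  have hdiff : ∀ t, 0 ≤ t → HasDerivWithinAt
      (fun τ => (w τ).incl r (Nat.le_add_right r 3)) (dw t) (Ici 0) t := by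
    intro t ht
    have du : HasDerivWithinAt (fun τ => (u τ).incl r (Nat.le_add_right r 3)) _ (Ici 0) t :=
      (huv.contDiff_u.differentiableOn (by norm_num) t ht).hasDerivWithinAt
    have dv : HasDerivWithinAt (fun τ => (v τ).incl r (Nat.le_add_right r 3)) _ (Ici 0) t :=
      (huv.contDiff_v.differentiableOn (by norm_num) t ht).hasDerivWithinAt
    exact (du.const_smul p).add (dv.const_smul q)
  have hdiffj : ∀ j ≤ r, ∀ t, 0 ≤ t →
      HasDerivWithinAt (fun τ => (w τ).jet j) ((dw t).jet j) (Ici 0) t := by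
    intro j hj t ht
    have := (Hper.dxL r j hj).hasFDerivAt.comp_hasDerivWithinAt t (hdiff t ht)
    rw [Hper.jet_eq hj]
    refine this.congr_of_eventuallyEq (Eventually.of_forall fun τ => ?_) ?_
    · exact Hper.jet_eq (by omega) _
    · exact Hper.jet_eq (by omega) _
  -- The mean value is conserved.
  have hmean_inner : ∀ t, (w t).mean = ⟪Lp.const 2 mu01 (1 : ℝ), (w t).jet 0⟫ := by
    intro t
    rw [real_inner_L2, Hper.mean, Hper.jet_eq (Nat.zero_le _)]
    apply integral_congr_ae
    filter_upwards [Lp.coeFn_const (p := 2) (μ := mu01) (1 : ℝ)] with x hx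
    rw [hx, Function.const_apply, one_mul]; rfl
  have hinner_int : ∀ f : L2, ⟪Lp.const 2 mu01 (1 : ℝ), f⟫ = ∫ x, f x ∂mu01 := by
    intro f
    rw [real_inner_L2]
    apply integral_congr_ae
    filter_upwards [Lp.coeFn_const (p := 2) (μ := mu01) (1 : ℝ)] with x hx
    rw [hx, Function.const_apply, one_mul]
  have hmean : ∀ t, 0 ≤ t → (w t).mean = (w 0).mean := by
    have hder : ∀ t, 0 ≤ t → HasDerivWithinAt (fun τ => (w τ).mean) 0 (Ici 0) t := by
      intro t ht
      have d := (innerSL ℝ (Lp.const 2 mu01 (1 : ℝ))).hasFDerivAt.comp_hasDerivWithinAt t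
        (hdiffj 0 (Nat.zero_le r) t ht)
      have T := (w t).isTower_jet
      have e : ⟪Lp.const 2 mu01 (1 : ℝ), (dw t).jet 0⟫ = 0 := by
        have i1 : ⟪Lp.const 2 mu01 (1 : ℝ), (w t).jet 3⟫ = 0 := by
          rw [hinner_int]; exact (T 2 (by omega)).integral_eq_zero
        have i2 : ⟪Lp.const 2 mu01 (1 : ℝ), mulL2 ((w t).jet 0) ((w t).jet 1)⟫ = 0 := by
          rw [hinner_int]; exact integral_mulL2_deriv (T 0 (by omega))
        have i3 : ⟪Lp.const 2 mu01 (1 : ℝ), Lp.const 2 mu01 (w t).mean⟫ = (w t).mean := by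
          rw [hinner_int, integral_congr_ae (Lp.coeFn_const (p := 2) (μ := mu01) (w t).mean)]
          simp
        rw [heq t ht]
        simp only [inner_neg_right, inner_add_right, inner_sub_right, inner_smul_right, i1, i2, i3,
          ← hmean_inner]
        ring
      have d' : HasDerivWithinAt (fun τ => ⟪Lp.const 2 mu01 (1 : ℝ), (w τ).jet 0⟫)
        ⟪Lp.const 2 mu01 (1 : ℝ), (dw t).jet 0⟫ (Ici 0) t := d
      rw [e] at d'
      exact d'.congr (fun τ _ => hmean_inner τ) (hmean_inner t)
    intro t ht
    refine constant_of_has_deriv_right_zero (f := fun τ => (w τ).mean) (a := 0) (b := t)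
      (fun τ hτ => ((hder τ hτ.1).continuousWithinAt).mono fun x hx => hx.1)
      (fun τ hτ => (hder τ hτ.1).mono fun x hx => hτ.1.trans hx) t ⟨ht, le_rfl⟩
  set m := (w 0).mean with hm
  set z : ℝ → ℕ → L2 := fun t => (w t - Hper.const (r + 3) m).jet with hz
  have hz0 : ∀ t, z t 0 = (w t).jet 0 - Lp.const 2 mu01 m := fun t => by
    rw [hz, Hper.jet_eq (Nat.zero_le _)]
    dsimp only
    rw [Hper.jet_eq (Nat.zero_le _), Hper.dx_zero_sub_const]
  have hzs : ∀ t, ∀ j, j + 1 ≤ r + 3 → z t (j + 1) = (w t).jet (j + 1) := fun t j hj => by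
    rw [hz, Hper.jet_eq hj]
    dsimp only
    rw [Hper.jet_eq hj, Hper.dx_succ_sub_const]
  have hK : IsDampedKdV α (lam * m) lam k r z fun t => (dw t).jet := by
    refine ⟨fun t _ => Hper.isTower_jet _, fun t _ => Hper.isTower_jet _, fun j hj => ?_,
      fun j hj t ht => ?_, fun t ht => ?_⟩
    · have : ContinuousOn (fun t => Hper.dxL (r + 3) j hj (w t - Hper.const (r + 3) m)) (Ici 0) :=
        (Hper.dxL (r + 3) j hj).continuous.comp_continuousOn (hwc.sub continuousOn_const)
      exact this.congr fun t _ => Hper.jet_eq hj _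
    · have d := hdiffj j hj t ht
      match j, hj with
      | 0, _ =>
        simp only [hz0]
        exact d.sub_const _
      | j + 1, hj =>
        simp only [hzs _ j (by omega)]
        exact d
    · have T : IsPeriodicWeakDeriv (z t 0) (z t 1) :=
        (w t - Hper.const (r + 3) m).isTower_jet 0 (by omega)
      have T' := (w t).isTower_jet 0 (by omega)
      have e1 : mulL2 ((w t).jet 0) ((w t).jet 1)
          = mulL2 (z t 0) (z t 1) + m • z t 1 := by
        rw [hzs t 0 (by omega)]
        have e0 := hz0 t
        have T0 := T.memLp_top
        rw [e0] at T0 ⊢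
        refine Lp.ext ?_
        filter_upwards [coeFn_mulL2 T'.memLp_top ((w t).jet 1), coeFn_mulL2 T0 ((w t).jet 1),
          Lp.coeFn_sub ((w t).jet 0) (Lp.const 2 mu01 m),
          Lp.coeFn_const (p := 2) (μ := mu01) m, Lp.coeFn_smul m ((w t).jet (0 + 1)),
          Lp.coeFn_add (mulL2 ((w t).jet 0 - Lp.const 2 mu01 m) ((w t).jet (0 + 1)))
            (m • (w t).jet (0 + 1))] with x x1 x2 x3 x4 x5 x6
        rw [x6, Pi.add_apply, x5, Pi.smul_apply, x1, x2, x3, Pi.sub_apply, x4,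
          Function.const_apply, smul_eq_mul]
        ring
      rw [heq t ht, hmean t ht, e1, hz0, hzs t 0 (by omega), hzs t 2 (by omega)]
      simp only [smul_add, mul_smul]
      abel
  have hdec := hK.decay hd.pos hk
  choose! K hK0 hKb using hdec
  refine ⟨∑ i ∈ Finset.range (r + 3 + 1), K i, fun t ht => ?_⟩
  have e : (p • u t + q • v t).mean = m := hmean t ht
  rw [e]
  refine (Hper.norm_le_sum_jet _).trans ?_
  rw [towerNorm, Finset.sum_mul]
  refine Finset.sum_le_sum fun i hi => ?_
  rw [Finset.mem_range] at hi
  exact hKb i (by omega) t ht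

end Decoupling

end GearGrimshaw

end

theorem theorem1p2 (a₁ a₂ a₃ b₁ b₂ r k : ℝ) (hk : 0 < k)
    (hb₁ : b₁ = 1) (hb₂ : b₂ = 1)
    (hr : r = 0) (ha : a₁ ^ 2 + a₂ ^ 2 = a₁ + a₂) (ha₃ : |a₃| < 1)
    (ha₁₃ : (a₁ - 1) * a₃ = 0) (ha₂₃ : (a₂ - 1) * a₃ = 0)
    (s : ℕ) (hs : 3 ≤ s) (φ ψ : GearGrimshaw.Hper s) (u v : ℝ → GearGrimshaw.Hper s)
    (huv : GearGrimshaw.IsSolution a₁ a₂ a₃ b₁ b₂ r k hs φ ψ u v)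
    (k' : ℝ) (hk' : k' < k) :
    (fun t : ℝ => ‖u t - GearGrimshaw.Hper.const s (u t).mean‖
        + ‖v t - GearGrimshaw.Hper.const s (v t).mean‖)
      =o[atTop] fun t : ℝ => Real.exp (-k' * t) := by
  subst hb₁ hb₂ hr
  obtain ⟨n, rfl⟩ := Nat.exists_eq_add_of_le' hs
  obtain ⟨α, lam, p, q, α', lam', p', q', hd, hd', hdet⟩ :=
    GearGrimshaw.exists_isDecoupling ha ha₃ ha₁₃ ha₂₃
  obtain ⟨K, hK⟩ := huv.decay_component hk hd
  obtain ⟨K', hK'⟩ := huv.decay_component hk hd'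
  set D := p * q' - q * p' with hD
  set w : ℝ → GearGrimshaw.Hper (n + 3) := fun t => p • u t + q • v t
  set w' : ℝ → GearGrimshaw.Hper (n + 3) := fun t => p' • u t + q' • v t
  have hu : ∀ t, u t = (D⁻¹ * q') • w t + (-(D⁻¹ * q)) • w' t := by
    intro t
    have e1 : D⁻¹ * q' * p + -(D⁻¹ * q) * p' = 1 := by
      linear_combination (inv_mul_cancel₀ hdet) + D⁻¹ * hD.symm
    have e2 : D⁻¹ * q' * q + -(D⁻¹ * q) * q' = 0 := by ring
    calc u t = (1 : ℝ) • u t + (0 : ℝ) • v t := by module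
      _ = _ := by rw [← e1, ← e2]; simp only [w, w']; module
  have hv : ∀ t, v t = (-(D⁻¹ * p')) • w t + (D⁻¹ * p) • w' t := by
    intro t
    have e1 : -(D⁻¹ * p') * p + D⁻¹ * p * p' = 0 := by ring
    have e2 : -(D⁻¹ * p') * q + D⁻¹ * p * q' = 1 := by
      linear_combination (inv_mul_cancel₀ hdet) + D⁻¹ * hD.symm
    calc v t = (0 : ℝ) • u t + (1 : ℝ) • v t := by module
      _ = _ := by rw [← e1, ← e2]; simp only [w, w']; module
  have bound : ∀ c c' t, 0 ≤ t → ‖c • w t + c' • w' t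
      - GearGrimshaw.Hper.const (n + 3) (c • w t + c' • w' t).mean‖
      ≤ (|c| * K + |c'| * K') * Real.exp (-k * t) := by
    intro c c' t ht
    rw [GearGrimshaw.Hper.sub_const_mean_add_smul]
    refine (norm_add_le _ _).trans ?_
    rw [norm_smul, norm_smul, Real.norm_eq_abs, Real.norm_eq_abs]
    have h1 := mul_le_mul_of_nonneg_left (hK t ht) (abs_nonneg c)
    have h2 := mul_le_mul_of_nonneg_left (hK' t ht) (abs_nonneg c')
    linarith
  have hO : (fun t : ℝ => ‖u t - GearGrimshaw.Hper.const (n + 3) (u t).mean‖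
      + ‖v t - GearGrimshaw.Hper.const (n + 3) (v t).mean‖)
      =O[atTop] fun t : ℝ => Real.exp (-k * t) := by
    refine IsBigO.of_bound ((|D⁻¹ * q'| * K + |-(D⁻¹ * q)| * K')
      + (|-(D⁻¹ * p')| * K + |D⁻¹ * p| * K')) ?_
    filter_upwards [eventually_ge_atTop 0] with t ht
    rw [Real.norm_of_nonneg (by positivity), Real.norm_of_nonneg (Real.exp_pos _).le, add_mul]
    have h1 := bound (D⁻¹ * q') (-(D⁻¹ * q)) t ht
    have h2 := bound (-(D⁻¹ * p')) (D⁻¹ * p) t ht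
    rw [← hu] at h1
    rw [← hv] at h2
    exact add_le_add h1 h2
  refine hO.trans_isLittleO (Real.isLittleO_exp_comp_exp_comp.2 ?_)
  have e : (fun t : ℝ => -k' * t - -k * t) = fun t => (k - k') * t := by ext; ring
  rw [e]
  exact tendsto_id.const_mul_atTop (sub_pos.2 hk')
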